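/- Let $dg$ be the Haar probability measure on $\mathrm{SU}(2)$, let $\mathrm{st}$ be the standard representation of $\mathrm{SU}(2)$ on $\mathbb{C}^2$, let $\mathrm{sym}^m$ be its $m$-th symmetric power, and let $\chi_{\mathrm{sym}^m}$ be the character of $\mathrm{sym}^m$. For a representation $\rho$ of $\mathrm{SU}(2)$, put $D(X,\rho,g)=\det[I-X\rho(g)]^{-1}$. For $z\in\mathbb{C}$ define $$L^{1,z}\left(\tfrac12,1;\mathrm{st},\mathrm{sym}^m\right)=\prod_{p}\int_{\mathrm{SU}(2)}D(p^{-1/2},\mathrm{st},g)\,D(p^{-1},\mathrm{sym}^m,g)^z\,dg,$$ $$L^{1,z}\left(1,1;\mathrm{sym}^2,\mathrm{sym}^m\right)=\prod_{p}\int_{\mathrm{SU}(2)}D(p^{-1},\mathrm{sym}^2,g)\,D(p^{-1},\mathrm{sym}^m,g)^z\,dg,$$ where $p$ runs over all primes. Let $\gamma^*=\lim_{x\to+\infty}\bigl(\sum_{p\le x}\frac1p-\log\log x\bigr)$; this constant satisfies $$\sum_{p\le x}\frac1p=\log\log x+\gamma^*+O\left(\frac1{\log x}\right)\qquad(x\ge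 2).$$ For either choice of sign define $$\mathrm{sym}^m_{\pm}=\max_{g\in\mathrm{SU}(2)}\pm\chi_{\mathrm{sym}^m}(g),$$ $$\mathrm{sym}^{m,1}_{\pm}=\gamma^*\,\mathrm{sym}^m_{\pm}+\sum_{p}\left\{\pm\log\left(\pm\max_{g\in\mathrm{SU}(2)}\pm D(p^{-1},\mathrm{sym}^m,g)\right)-\frac{\mathrm{sym}^m_{\pm}}{p}\right\}.$$ Proposition. Let $m\in\{1,2,4\}$. The series defining $\mathrm{sym}^{m,1}_{\pm}$ converge absolutely. For every real $z$, both Euler products above converge (unconditionally) to positive real numbers. As $r\to+\infty$ in $\mathbb{R}$, for either choice of sign, $$\log L^{1,\pm r}\left(\tfrac12,1;\mathrm{st},\mathrm{sym}^m\right)=\mathrm{sym}^m_{\pm}\,r\log\log r+\mathrm{sym}^{m,1}_{\pm}\,r+O_m\left(\frac{r}{\log r}\right)$$ and $$\log L^{1,\pm r}\left(1,1;\mathrm{sym}^2,\mathrm{sym}^m\right)=\mathrm{sym}^m_{\pm}\,r\log\log r+\mathrm{sym}^{m,1}_{\pm}\,r+O_m\left(\frac{r}{\log r}\right).$$ -/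

import Mathlib

open MeasureTheory Filter Topology Asymptotics

noncomputable section

namespace SymPow

/-! ### The compact group `SU(2)` and its normalised Haar measure -/

/-- The group `SU(2)`. -/
abbrev SU2 : Type := Matrix.specialUnitaryGroup (Fin 2) ℂ

instance instContinuousMulSU2 : ContinuousMul SU2 where
  continuous_mul :=
    ((continuous_subtype_val.comp continuous_fst).matrix_mul
      (continuous_subtype_val.comp continuous_snd)).subtype_mk _

instance instContinuousInvSU2 : ContinuousInv SU2 where
  continuous_inv := (continuous_subtype_val.matrix_conjTranspose).subtype_mk _

instance instIsTopologicalGroupSU2 : IsTopologicalGroup SU2 where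

instance instCompactSpaceSU2 : CompactSpace SU2 := by
  refine isCompact_iff_compactSpace.mp ?_
  have hsub : ((Matrix.specialUnitaryGroup (Fin 2) ℂ : Submonoid (Matrix (Fin 2) (Fin 2) ℂ)) :
      Set (Matrix (Fin 2) (Fin 2) ℂ)) ⊆
      Set.pi Set.univ fun _ : Fin 2 => Set.pi Set.univ fun _ : Fin 2 =>
        Metric.closedBall (0 : ℂ) 1 := by
    intro A hA i _ j _
    rw [mem_closedBall_zero_iff]
    exact entry_norm_bound_of_unitary (Matrix.specialUnitaryGroup_le_unitaryGroup hA) i j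
  refine IsCompact.of_isClosed_subset ?_ ?_ hsub
  · exact isCompact_univ_pi fun _ => isCompact_univ_pi fun _ => isCompact_closedBall _ _
  · have : ((Matrix.specialUnitaryGroup (Fin 2) ℂ : Submonoid (Matrix (Fin 2) (Fin 2) ℂ)) :
        Set (Matrix (Fin 2) (Fin 2) ℂ)) =
        {A | A * A.conjTranspose = 1} ∩ {A | A.det = 1} := by
      ext A
      simp only [SetLike.mem_coe, Matrix.mem_specialUnitaryGroup_iff, Matrix.mem_unitaryGroup_iff,
        Matrix.star_eq_conjTranspose, Set.mem_inter_iff, Set.mem_ofPred_eq]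
    rw [this]
    exact (isClosed_eq (continuous_id.matrix_mul continuous_id.matrix_conjTranspose)
      continuous_const).inter (isClosed_eq continuous_id.matrix_det continuous_const)

instance instMeasurableSpaceSU2 : MeasurableSpace SU2 := borel SU2

instance instBorelSpaceSU2 : BorelSpace SU2 := ⟨rfl⟩

/-- The Haar measure of `SU(2)`, normalised to have total mass `1`. -/
def haarSU2 : Measure SU2 := Measure.haarMeasure ⊤

/-! ### Symmetric powers -/

/-- The polynomial `(a + c X) ^ (m - j) * (b + d X) ^ j` attached to `A = !![a, b; c, d]`. It is the
image under `A` of the monomial `e₀ ^ (m - j) * e₁ ^ j` of the `m`-th symmetric power of `ℂ²`,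
dehomogenised by `e₀ = 1` and `e₁ = X`. -/
def symPoly (m : ℕ) (A : Matrix (Fin 2) (Fin 2) ℂ) (j : ℕ) : Polynomial ℂ :=
  (Polynomial.C (A 0 0) + Polynomial.C (A 1 0) * Polynomial.X) ^ (m - j) *
    (Polynomial.C (A 0 1) + Polynomial.C (A 1 1) * Polynomial.X) ^ j

/-- The matrix of the `m`-th symmetric power of `A`, in the basis `e₀ ^ (m - i) * e₁ ^ i`,
`0 ≤ i ≤ m`. -/
def symMatrix (m : ℕ) (A : Matrix (Fin 2) (Fin 2) ℂ) : Matrix (Fin (m + 1)) (Fin (m + 1)) ℂ :=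
  Matrix.of fun i j => (symPoly m A j).coeff i

lemma natDegree_linear_le (a c : ℂ) :
    (Polynomial.C a + Polynomial.C c * Polynomial.X).natDegree ≤ 1 := by
  rw [add_comm]
  exact Polynomial.natDegree_linear_le

lemma homogenize_linear_pow (a c : ℂ) (k : ℕ) :
    ((Polynomial.C a + Polynomial.C c * Polynomial.X) ^ k).homogenize k =
      (MvPolynomial.C a * MvPolynomial.X 1 + MvPolynomial.C c * MvPolynomial.X 0) ^ k := by
  induction k with
  | zero => simp
  | succ k ih =>
    rw [pow_succ, Polynomial.homogenize_mul, ih, pow_succ]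
    · simp
    · exact (Polynomial.natDegree_pow_le).trans
        ((Nat.mul_le_mul_left k (natDegree_linear_le a c)).trans (by simp))
    · exact natDegree_linear_le a c

/-- Substituting `u`, `v` for `e₀`, `e₁` in the image of a basis monomial. -/
lemma sum_symPoly (m : ℕ) (B : Matrix (Fin 2) (Fin 2) ℂ) {j : ℕ} (hj : j ≤ m)
    (u v : Polynomial ℂ) :
    ∑ k : Fin (m + 1), Polynomial.C ((symPoly m B j).coeff k) * (u ^ (m - (k : ℕ)) * v ^ (k : ℕ)) =
      (Polynomial.C (B 0 0) * u + Polynomial.C (B 1 0) * v) ^ (m - j) *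
        (Polynomial.C (B 0 1) * u + Polynomial.C (B 1 1) * v) ^ j := by
  have h1 : (symPoly m B j).homogenize m =
      (MvPolynomial.C (B 0 0) * MvPolynomial.X 1 + MvPolynomial.C (B 1 0) * MvPolynomial.X 0)
        ^ (m - j) *
      (MvPolynomial.C (B 0 1) * MvPolynomial.X 1 + MvPolynomial.C (B 1 1) * MvPolynomial.X 0)
        ^ j := by
    rw [← homogenize_linear_pow, ← homogenize_linear_pow]
    have hm : m = (m - j) + j := by omega
    conv_lhs => rw [hm]
    rw [← Polynomial.homogenize_mul]
    · simp only [symPoly, ← hm]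
    · exact (Polynomial.natDegree_pow_le).trans
        ((Nat.mul_le_mul_left _ (natDegree_linear_le _ _)).trans (by simp))
    · exact (Polynomial.natDegree_pow_le).trans
        ((Nat.mul_le_mul_left _ (natDegree_linear_le _ _)).trans (by simp))
  have h2 := congrArg (MvPolynomial.aeval ![v, u]) h1
  rw [Polynomial.homogenize, Finset.Nat.sum_antidiagonal_eq_sum_range_succ_mk] at h2
  rw [Finset.sum_range] at h2
  simp [MvPolynomial.aeval_monomial, Finsupp.update_eq_add_single, Finsupp.prod_add_index',
    pow_add] at h2
  rw [← h2]
  exact Finset.sum_congr rfl fun k _ => by ring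

lemma symMatrix_mul (m : ℕ) (A B : Matrix (Fin 2) (Fin 2) ℂ) :
    symMatrix m (A * B) = symMatrix m A * symMatrix m B := by
  ext i j
  have hj : (j : ℕ) ≤ m := Nat.lt_succ_iff.mp j.2
  have h := congrArg (fun P : Polynomial ℂ => P.coeff (i : ℕ))
    (sum_symPoly m B hj (Polynomial.C (A 0 0) + Polynomial.C (A 1 0) * Polynomial.X)
      (Polynomial.C (A 0 1) + Polynomial.C (A 1 1) * Polynomial.X))
  simp only [Polynomial.finsetSum_coeff, Polynomial.coeff_C_mul] at h
  simp only [symMatrix, Matrix.mul_apply, Matrix.of_apply]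
  have h3 : symPoly m (A * B) j =
      (Polynomial.C (B 0 0) * (Polynomial.C (A 0 0) + Polynomial.C (A 1 0) * Polynomial.X) +
        Polynomial.C (B 1 0) * (Polynomial.C (A 0 1) + Polynomial.C (A 1 1) * Polynomial.X))
          ^ (m - (j : ℕ)) *
      (Polynomial.C (B 0 1) * (Polynomial.C (A 0 0) + Polynomial.C (A 1 0) * Polynomial.X) +
        Polynomial.C (B 1 1) * (Polynomial.C (A 0 1) + Polynomial.C (A 1 1) * Polynomial.X))
          ^ (j : ℕ) := by
    simp only [symPoly, Matrix.mul_apply, Fin.sum_univ_two, Polynomial.C_add, Polynomial.C_mul]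
    congr 2 <;> ring
  rw [h3, ← h]
  exact Finset.sum_congr rfl fun k _ => by rw [mul_comm]; rfl

lemma symMatrix_one (m : ℕ) : symMatrix m 1 = 1 := by
  ext i j
  simp [symMatrix, symPoly, Polynomial.coeff_X_pow, Matrix.one_apply, Fin.ext_iff]

/-- The standard representation `st` of `SU(2)` on `ℂ²`. -/
def st : SU2 →* Matrix (Fin 2) (Fin 2) ℂ := (Matrix.specialUnitaryGroup (Fin 2) ℂ).subtype

/-- The representation `sym^m` of `SU(2)`: the `m`-th symmetric power of `st`. -/
def sym (m : ℕ) : SU2 →* Matrix (Fin (m + 1)) (Fin (m + 1)) ℂ where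
  toFun g := symMatrix m (st g)
  map_one' := by rw [map_one, symMatrix_one]
  map_mul' g h := by rw [map_mul, symMatrix_mul]

/-- The character `χ_ρ` of a representation `ρ` of `SU(2)`. -/
def character {n : ℕ} (ρ : SU2 →* Matrix (Fin n) (Fin n) ℂ) (g : SU2) : ℂ := (ρ g).trace

/-- `D(X, ρ, g) = det (I - X ρ(g))⁻¹`. -/
def eulerD {n : ℕ} (X : ℂ) (ρ : SU2 →* Matrix (Fin n) (Fin n) ℂ) (g : SU2) : ℂ :=
  ((1 - X • ρ g).det)⁻¹

/-! ### The Euler products -/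

/-- The local factor at `p`: the integral over `SU(2)` of
`D(p ^ (-s₁), ρ₁, g) * D(p ^ (-s₂), ρ₂, g) ^ z`. -/
def localFactor {n₁ n₂ : ℕ} (s₁ s₂ : ℂ) (ρ₁ : SU2 →* Matrix (Fin n₁) (Fin n₁) ℂ)
    (ρ₂ : SU2 →* Matrix (Fin n₂) (Fin n₂) ℂ) (z : ℂ) (p : Nat.Primes) : ℂ :=
  ∫ g : SU2, eulerD ((p : ℂ) ^ (-s₁)) ρ₁ g * eulerD ((p : ℂ) ^ (-s₂)) ρ₂ g ^ z ∂haarSU2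

/-- `L^{1,z}(s₁, s₂; ρ₁, ρ₂)`: the product of the local factors over all primes. -/
def twistedL {n₁ n₂ : ℕ} (s₁ s₂ : ℂ) (ρ₁ : SU2 →* Matrix (Fin n₁) (Fin n₁) ℂ)
    (ρ₂ : SU2 →* Matrix (Fin n₂) (Fin n₂) ℂ) (z : ℂ) : ℂ :=
  ∏' p : Nat.Primes, localFactor s₁ s₂ ρ₁ ρ₂ z p

/-! ### The constants -/

/-- The sum of `1 / p` over the primes `p ≤ x`. -/
def primeRecipSum (x : ℝ) : ℝ := ∑ p ∈ Finset.Icc 1 ⌊x⌋₊ with p.Prime, 1 / (p : ℝ)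

/-- The constant `γ*`: the limit of `∑_{p ≤ x} 1 / p - log log x` as `x → +∞`. -/
def gammaStar : ℝ := limUnder atTop fun x : ℝ => primeRecipSum x - Real.log (Real.log x)

/-- `sym^m_±`, the maximum over `g ∈ SU(2)` of `± χ_{sym^m}(g)`; the sign is `ε = ± 1`.
The character is real valued and continuous on a compact group, so the supremum is a maximum. -/
def symSup (m : ℕ) (ε : ℝ) : ℝ := ⨆ g : SU2, ε * (character (sym m) g).re

/-- The maximum over `g ∈ SU(2)` of `± D(p⁻¹, sym^m, g)`; the sign is `ε = ± 1`.
These values are real and continuous in `g`, so the supremum is a maximum. -/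
def eulerDSup (m : ℕ) (ε : ℝ) (p : Nat.Primes) : ℝ :=
  ⨆ g : SU2, ε * (eulerD ((p : ℂ)⁻¹) (sym m) g).re

/-- The summand `± log (± max (± D(p⁻¹, sym^m, g))) - sym^m_± / p`. -/
def symOneTerm (m : ℕ) (ε : ℝ) (p : Nat.Primes) : ℝ :=
  ε * Real.log (ε * eulerDSup m ε p) - symSup m ε / (p : ℝ)

/-- The constant `sym^{m,1}_±`. -/
def symOne (m : ℕ) (ε : ℝ) : ℝ := gammaStar * symSup m ε + ∑' p : Nat.Primes, symOneTerm m ε p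

/-- The main term `sym^m_± r log log r + sym^{m,1}_± r`. -/
def mainTerm (m : ℕ) (ε r : ℝ) : ℝ :=
  symSup m ε * r * Real.log (Real.log r) + symOne m ε * r

end SymPow

end

/-!
On `SU(2)` the character and the characteristic polynomials of `sym^m` are Chebyshev polynomials in
the trace `t = tr g`, so each Euler factor is the integral over `SU(2)` of a positive weight times
`exp (r f_p (t))`, where `f_p = ± log D(p⁻¹, sym^m, ·)`.

For `p > r`, expand the exponential: `f_p` equals `± χ(g) / p` up to `O(p⁻²)`, and nontrivial
irreducible characters have mean `0` because `sym^m` has no invariant vector. The factor is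
therefore `1 + O(r² / p² + r p ^ (-3 / 2))`, and by Chebyshev's estimates these primes contribute
`O(r / log r)` to the logarithm of the product.

For `p ≤ r`, the integral is at most `exp (r max f_p)` times the supremum of the weight. Since `f_p`
is Lipschitz with constant `O(1 / p)`, it stays within `O(1 / r)` of its maximum on a neighbourhood
of radius of order `p / r`, whose Haar measure is at least a constant times a power of `p / r` by a
pigeonhole argument and translation invariance. Hence the logarithm of the factor is `r max f_p` up
to `O(1 + log (r / p))`, and `∑_{p ≤ r} (1 + log (r / p)) = O(r / log r)`. The sum of `r max f_p`
over `p ≤ r` is evaluated by Mertens' second theorem.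
-/

namespace SymPow

/-! ### Mertens' second theorem -/

lemma summable_log_mul_rpow {s : ℝ} (hs : s < -1) :
    Summable fun n : ℕ ↦ Real.log n * (n : ℝ) ^ s := by
  obtain ⟨t, hst, ht⟩ := exists_between hs
  refine summable_of_isBigO_nat (Real.summable_nat_rpow.mpr ht) ?_
  have h := ((isLittleO_log_rpow_atTop (sub_pos.mpr hst)).isBigO.mul
    (isBigO_refl (fun x : ℝ ↦ x ^ s) atTop)).comp_tendsto tendsto_natCast_atTop_atTop
  refine h.congr' .rfl ?_
  filter_upwards [eventually_gt_atTop 0] with n hn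
  rw [Function.comp_apply, ← Real.rpow_add (Nat.cast_pos.mpr hn), sub_add_cancel]

lemma log_factorial_eq_sum (n : ℕ) :
    Real.log n.factorial = ∑ p ∈ n.primesLE, padicValNat p n.factorial * Real.log p := by
  rw [Real.log_nat_eq_sum_factorization, Finsupp.sum_of_support_subset (s := n.primesLE)]
  · refine Finset.sum_congr rfl fun p hp ↦ ?_
    rw [Nat.factorization_def _ (Nat.prime_of_mem_primesLE hp)]
  · intro p hp
    have hp' := Nat.support_factorization _ ▸ hp
    have hprime := Nat.prime_of_mem_primeFactors hp'
    exact Nat.mem_primesLE.mpr ⟨hprime.dvd_factorial.mp (Nat.dvd_of_mem_primeFactors hp'), hprime⟩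
  · simp

lemma log_factorial_le (n : ℕ) : Real.log n.factorial ≤ n * Real.log n := by
  rw [← Real.log_pow]
  exact Real.log_le_log (by exact_mod_cast n.factorial_pos) (by exact_mod_cast n.factorial_le_pow)

lemma le_log_factorial (n : ℕ) : n * Real.log n - n ≤ Real.log n.factorial := by
  rcases n.eq_zero_or_pos with rfl | hn
  · simp
  have hn' : (0 : ℝ) < n := Nat.cast_pos.mpr hn
  have hf : (0 : ℝ) < n.factorial := Nat.cast_pos.mpr n.factorial_pos
  have h := Real.log_le_log (by positivity) (Real.pow_div_factorial_le_exp (n : ℝ) hn'.le n)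
  rw [Real.log_exp, Real.log_div (by positivity) hf.ne', Real.log_pow] at h
  linarith

lemma div_sub_one_le_padicValNat_factorial (p n : ℕ) [Fact p.Prime] :
    (n : ℝ) / p - 1 ≤ padicValNat p n.factorial := by
  have hle : n / p ≤ padicValNat p n.factorial := by
    rw [padicValNat_factorial (Nat.lt_add_of_pos_right (n := Nat.log p n) two_pos)]
    simpa using Finset.single_le_sum (f := fun i ↦ n / p ^ i) (fun i _ ↦ Nat.zero_le _)
      (show 1 ∈ Finset.Ico 1 (Nat.log p n + 2) by simp)
  have hfloor : (n : ℝ) / p < (n / p : ℕ) + 1 := by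
    rw [← Nat.floor_div_eq_div (K := ℝ)]
    exact Nat.lt_floor_add_one _
  linarith [(Nat.cast_le (α := ℝ)).mpr hle]

lemma padicValNat_factorial_le_mul (p n : ℕ) [hp : Fact p.Prime] :
    (padicValNat p n.factorial : ℝ) ≤ n * (1 / p + 2 / (p : ℝ) ^ 2) := by
  have hp2 : (2 : ℝ) ≤ p := by exact_mod_cast hp.out.two_le
  have hle : ((p : ℝ) - 1) * padicValNat p n.factorial ≤ n := by
    have h : (p - 1) * padicValNat p n.factorial ≤ n :=
      (sub_one_mul_padicValNat_factorial n).le.trans (Nat.sub_le _ _)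
    rw [← Nat.cast_pred hp.out.pos]
    exact_mod_cast h
  have hgeom : 1 ≤ ((p : ℝ) - 1) * (1 / p + 2 / (p : ℝ) ^ 2) := by
    field_simp
    nlinarith
  nlinarith [(Nat.cast_nonneg (α := ℝ) n)]

/-- The sum `∑_{p ≤ n} log p / p` over primes, the subject of Mertens' first theorem. -/
noncomputable def primeLogSum (n : ℕ) : ℝ := ∑ p ∈ n.primesLE, Real.log p / p

lemma primeLogSum_le {n : ℕ} (hn : n ≠ 0) : primeLogSum n ≤ Real.log n + Real.log 4 := by
  have hn' : (0 : ℝ) < n := by positivity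
  have hsum : n * primeLogSum n - Chebyshev.theta n ≤ Real.log n.factorial := by
    rw [log_factorial_eq_sum, Chebyshev.theta_eq_sum_primesLE_log, primeLogSum, Finset.mul_sum,
      ← Finset.sum_sub_distrib]
    refine Finset.sum_le_sum fun p hp ↦ ?_
    have := Fact.mk (Nat.prime_of_mem_primesLE hp)
    calc n * (Real.log p / p) - Real.log p = (n / p - 1) * Real.log p := by ring
      _ ≤ _ := mul_le_mul_of_nonneg_right (div_sub_one_le_padicValNat_factorial p n)
          (Real.log_natCast_nonneg p)
  refine le_of_mul_le_mul_left ?_ hn'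
  linarith [Chebyshev.theta_le_log4_mul_x hn'.le, log_factorial_le n]

lemma exists_log_sub_le_primeLogSum : ∃ C : ℝ, ∀ n : ℕ, n ≠ 0 → Real.log n - C ≤ primeLogSum n := by
  have hsummable := summable_log_mul_rpow (s := -2) (by norm_num)
  refine ⟨1 + 2 * ∑' n : ℕ, Real.log n * (n : ℝ) ^ (-2 : ℝ), fun n hn ↦ ?_⟩
  have hn' : (0 : ℝ) < n := by positivity
  have hsum : Real.log n.factorial ≤
      n * primeLogSum n + 2 * n * ∑ p ∈ n.primesLE, Real.log p * (p : ℝ) ^ (-2 : ℝ) := by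
    rw [log_factorial_eq_sum, primeLogSum, Finset.mul_sum, Finset.mul_sum, ← Finset.sum_add_distrib]
    refine Finset.sum_le_sum fun p hp ↦ ?_
    have := Fact.mk (Nat.prime_of_mem_primesLE hp)
    calc _ ≤ n * (1 / p + 2 / (p : ℝ) ^ 2) * Real.log p :=
          mul_le_mul_of_nonneg_right (padicValNat_factorial_le_mul p n) (Real.log_natCast_nonneg p)
      _ = _ := by
        rw [Real.rpow_neg p.cast_nonneg, Real.rpow_two]
        ring
  have htsum := hsummable.sum_le_tsum n.primesLE fun k _ ↦
    mul_nonneg (Real.log_natCast_nonneg k) (by positivity)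
  refine le_of_mul_le_mul_left ?_ hn'
  nlinarith [le_log_factorial n]

lemma exists_abs_primeLogSum_sub_log_le :
    ∃ C : ℝ, ∀ n : ℕ, n ≠ 0 → |primeLogSum n - Real.log n| ≤ C := by
  obtain ⟨C, hC⟩ := exists_log_sub_le_primeLogSum
  refine ⟨max C (Real.log 4), fun n hn ↦ abs_le.mpr ⟨?_, ?_⟩⟩
  · linarith [hC n hn, le_max_left C (Real.log 4)]
  · linarith [primeLogSum_le hn, le_max_right C (Real.log 4)]

lemma exists_abs_sub_le_of_abs_sub_le {E g : ℕ → ℝ} (hg : Tendsto g atTop (𝓝 0))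
    (h : ∀ n, |E (n + 1) - E n| ≤ g n - g (n + 1)) : ∃ l, ∀ n, |E n - l| ≤ g n := by
  have hupper : Antitone fun n ↦ E n + g n :=
    antitone_nat_of_succ_le fun n ↦ by linarith [(abs_le.mp (h n)).2]
  have hlower : Monotone fun n ↦ E n - g n :=
    monotone_nat_of_le_succ fun n ↦ by linarith [(abs_le.mp (h n)).1]
  have hg_anti : Antitone g :=
    antitone_nat_of_succ_le fun n ↦ by linarith [(abs_nonneg _).trans (h n)]
  have hmem := hlower.ciSup_mem_iInter_Icc_of_antitone hupper fun n ↦ by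
    linarith [hg_anti.le_of_tendsto hg n]
  refine ⟨⨆ n, (E n - g n), fun n ↦ ?_⟩
  obtain ⟨hl, hu⟩ := Set.mem_iInter.mp hmem n
  rw [abs_sub_comm, abs_le]
  constructor <;> linarith

lemma sum_primesLE_succ {M : Type*} [AddCommMonoid M] (f : ℕ → M) (n : ℕ) :
    ∑ p ∈ (n + 1).primesLE, f p =
      ∑ p ∈ n.primesLE, f p + if (n + 1).Prime then f (n + 1) else 0 := by
  rw [Nat.primesLE_succ]
  split_ifs
  · rw [Finset.sum_insert (Nat.notMem_primesLE n), add_comm]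
  · rw [add_zero]

lemma sum_inv_primesLE_succ (n : ℕ) :
    ∑ p ∈ (n + 1).primesLE, 1 / (p : ℝ) = ∑ p ∈ n.primesLE, 1 / (p : ℝ) +
      (primeLogSum (n + 1) - primeLogSum n) / Real.log (n + 1 : ℕ) := by
  rw [primeLogSum, primeLogSum, sum_primesLE_succ fun p ↦ 1 / (p : ℝ),
    sum_primesLE_succ fun p ↦ Real.log p / p, add_sub_cancel_left]
  split_ifs with h
  · have : Real.log (n + 1 : ℕ) ≠ 0 := (Real.log_pos (by exact_mod_cast h.one_lt)).ne'
    field_simp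
  · rw [zero_div]

lemma log_sub_log_le_div {a b : ℝ} (ha : 0 < a) (hb : 0 < b) :
    Real.log b - Real.log a ≤ (b - a) / a := by
  rw [← Real.log_div hb.ne' ha.ne', sub_div, div_self ha.ne']
  exact Real.log_le_sub_one_of_pos (div_pos hb ha)

lemma abs_div_sub_log_sub_log_le {a b : ℝ} (ha : 0 < a) (hab : a ≤ b) (hb : b ≤ a + 1) :
    |(b - a) / b - (Real.log b - Real.log a)| ≤ 1 / a - 1 / b := by
  have hb0 : 0 < b := ha.trans_le hab
  have hlower := log_sub_log_le_div hb0 ha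
  have hupper := log_sub_log_le_div ha hb0
  have hinv : 0 ≤ 1 / a - 1 / b := sub_nonneg.mpr (one_div_le_one_div_of_le ha hab)
  have hneg : (a - b) / b = -((b - a) / b) := by ring
  rw [abs_of_nonpos (by linarith)]
  calc _ ≤ (b - a) / a - (b - a) / b := by linarith
    _ = (b - a) * (1 / a - 1 / b) := by ring
    _ ≤ 1 * (1 / a - 1 / b) := mul_le_mul_of_nonneg_right (by linarith) hinv
    _ = _ := one_mul _

lemma log_add_one_le_log_add_one {x : ℝ} (hx : 1 ≤ x) : Real.log (x + 1) ≤ Real.log x + 1 := by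
  have h := log_sub_log_le_div (a := x) (b := x + 1) (by linarith) (by linarith)
  rw [add_sub_cancel_left] at h
  linarith [div_le_one_of_le₀ hx (by linarith)]

/-- The error term `∑_{p ≤ n} 1 / p - log log n` of Mertens' second theorem, corrected by the
boundary term of its partial summation against `primeLogSum`. -/
noncomputable def mertensError (n : ℕ) : ℝ :=
  ∑ p ∈ n.primesLE, 1 / (p : ℝ) - Real.log (Real.log n) -
    (primeLogSum n - Real.log n) / Real.log n

lemma abs_mertensError_succ_sub_le {C : ℝ}
    (hC : ∀ n : ℕ, n ≠ 0 → |primeLogSum n - Real.log n| ≤ C) {n : ℕ} (hn : 2 ≤ n) :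
    |mertensError (n + 1) - mertensError n| ≤
      (C + 1) / Real.log n - (C + 1) / Real.log (n + 1 : ℕ) := by
  have hn' : (2 : ℝ) ≤ n := by exact_mod_cast hn
  unfold mertensError
  rw [sum_inv_primesLE_succ]
  set a := Real.log n
  set b := Real.log (n + 1 : ℕ) with hb_def
  rw [Nat.cast_succ] at hb_def
  have ha : 0 < a := Real.log_pos (by linarith)
  have hab : a ≤ b := hb_def ▸ Real.log_le_log (by linarith) (by linarith)
  have hba : b ≤ a + 1 := hb_def ▸ log_add_one_le_log_add_one (by linarith)
  have hb : 0 < b := ha.trans_le hab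
  have hinv : 0 ≤ 1 / a - 1 / b := sub_nonneg.mpr (one_div_le_one_div_of_le ha hab)
  calc _ = |((b - a) / b - (Real.log b - Real.log a)) + (primeLogSum n - a) * (1 / a - 1 / b)| := by
        congr 1
        field_simp
        ring
    _ ≤ _ := abs_add_le _ _
    _ ≤ (1 / a - 1 / b) + C * (1 / a - 1 / b) := by
        refine add_le_add (abs_div_sub_log_sub_log_le ha hab hba) ?_
        rw [abs_mul, abs_of_nonneg hinv]
        exact mul_le_mul_of_nonneg_right (hC n (by omega)) hinv
    _ = _ := by ring

lemma exists_abs_sum_inv_primesLE_sub_le : ∃ C l : ℝ, ∀ n : ℕ, 2 ≤ n →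
    |∑ p ∈ n.primesLE, 1 / (p : ℝ) - (Real.log (Real.log n) + l)| ≤ C / Real.log n := by
  obtain ⟨C, hC⟩ := exists_abs_primeLogSum_sub_log_le
  have hlim : Tendsto (fun n : ℕ ↦ (C + 1) / Real.log (n + 2 : ℕ)) atTop (𝓝 0) :=
    (tendsto_const_nhds.div_atTop (Real.tendsto_log_atTop.comp
      tendsto_natCast_atTop_atTop)).comp (tendsto_add_atTop_nat 2)
  obtain ⟨l, hl⟩ := exists_abs_sub_le_of_abs_sub_le (E := fun n ↦ mertensError (n + 2)) hlim
    fun n ↦ abs_mertensError_succ_sub_le hC (n := n + 2) (by omega)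
  refine ⟨C + 1 + C, l, fun n hn ↦ ?_⟩
  obtain ⟨k, rfl⟩ := Nat.exists_eq_add_of_le' hn
  have hlog : 0 < Real.log (k + 2 : ℕ) := Real.log_pos (by exact_mod_cast hn)
  have hboundary : |(primeLogSum (k + 2) - Real.log (k + 2 : ℕ)) / Real.log (k + 2 : ℕ)| ≤
      C / Real.log (k + 2 : ℕ) := by
    rw [abs_div, abs_of_pos hlog]
    exact div_le_div_of_nonneg_right (hC _ (by omega)) hlog.le
  calc _ = |(mertensError (k + 2) - l) +
        (primeLogSum (k + 2) - Real.log (k + 2 : ℕ)) / Real.log (k + 2 : ℕ)| := by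
        rw [mertensError]
        ring_nf
    _ ≤ _ := abs_add_le _ _
    _ ≤ _ := add_le_add (hl k) hboundary
    _ = _ := by ring

lemma log_le_log_floor_add_one {x : ℝ} (hx : 1 ≤ x) : Real.log x ≤ Real.log ⌊x⌋₊ + 1 := by
  have h1 : (1 : ℝ) ≤ ⌊x⌋₊ := by exact_mod_cast Nat.le_floor (by simpa using hx)
  exact (Real.log_le_log (by linarith) (Nat.lt_floor_add_one x).le).trans
    (log_add_one_le_log_add_one h1)

lemma log_le_two_mul_log_floor {x : ℝ} (hx : 2 ≤ x) : Real.log x ≤ 2 * Real.log ⌊x⌋₊ := by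
  have h2 : (2 : ℝ) ≤ ⌊x⌋₊ := by exact_mod_cast Nat.le_floor (by simpa using hx)
  have h := Real.log_le_log (by linarith)
    (show x ≤ (⌊x⌋₊ : ℝ) ^ 2 by nlinarith [Nat.lt_floor_add_one x])
  rwa [Real.log_pow] at h

lemma exists_abs_primeRecipSum_sub_le : ∃ C l : ℝ, ∀ x : ℝ, 2 ≤ x →
    |primeRecipSum x - (Real.log (Real.log x) + l)| ≤ C / Real.log x := by
  obtain ⟨C, l, hC⟩ := exists_abs_sum_inv_primesLE_sub_le
  refine ⟨2 * (C + 1), l, fun x hx ↦ ?_⟩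
  have hfloor : 2 ≤ ⌊x⌋₊ := Nat.le_floor (by simpa using hx)
  have hsum := hC _ hfloor
  rw [Nat.primesLE_eq_filter_Icc_one, ← primeRecipSum] at hsum
  have hba := log_le_two_mul_log_floor hx
  have hba' := log_le_log_floor_add_one (by linarith : 1 ≤ x)
  have hab := Real.log_le_log (by positivity : (0 : ℝ) < ⌊x⌋₊) (Nat.floor_le (by linarith))
  have ha : 0 < Real.log ⌊x⌋₊ := Real.log_pos (by exact_mod_cast hfloor)
  set a := Real.log (⌊x⌋₊ : ℝ)
  set b := Real.log x
  have hb : 0 < b := ha.trans_le hab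
  have hC0 : 0 ≤ C := by
    have := (abs_nonneg _).trans hsum
    rwa [le_div_iff₀ ha, zero_mul] at this
  have hloglog : |Real.log b - Real.log a| ≤ 1 / a := by
    rw [abs_of_nonneg (sub_nonneg.mpr (Real.log_le_log ha hab))]
    exact (log_sub_log_le_div ha hb).trans (div_le_div_of_nonneg_right (by linarith) ha.le)
  calc _ = |(primeRecipSum x - (Real.log a + l)) - (Real.log b - Real.log a)| := by ring_nf
    _ ≤ _ := abs_sub _ _
    _ ≤ C / a + 1 / a := add_le_add hsum hloglog
    _ = (C + 1) / a := by ring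
    _ ≤ _ := by rw [div_le_div_iff₀ ha hb]; nlinarith

lemma exists_abs_primeRecipSum_sub_gammaStar_le : ∃ C : ℝ, ∀ x : ℝ, 2 ≤ x →
    |primeRecipSum x - (Real.log (Real.log x) + gammaStar)| ≤ C / Real.log x := by
  obtain ⟨C, l, hC⟩ := exists_abs_primeRecipSum_sub_le
  have hlim : Tendsto (fun x : ℝ ↦ primeRecipSum x - Real.log (Real.log x)) atTop (𝓝 l) := by
    rw [tendsto_iff_norm_sub_tendsto_zero]
    refine squeeze_zero' (.of_forall fun _ ↦ norm_nonneg _) ?_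
      (tendsto_const_nhds (x := C).div_atTop Real.tendsto_log_atTop)
    filter_upwards [eventually_ge_atTop 2] with x hx
    rw [Real.norm_eq_abs, sub_sub]
    exact hC x hx
  exact ⟨C, by rwa [show gammaStar = l from hlim.limUnder_eq]⟩

lemma sum_log_div_eq {r : ℝ} (hr : r ≠ 0) :
    ∑ p ∈ ⌊r⌋₊.primesLE, Real.log (r / p) =
      Nat.primeCounting ⌊r⌋₊ * Real.log r - Chebyshev.theta r := by
  rw [Chebyshev.theta_eq_sum_primesLE, ← Nat.primesLE_card_eq_primeCounting, ← nsmul_eq_mul,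
    ← Finset.sum_const, ← Finset.sum_sub_distrib]
  exact Finset.sum_congr rfl fun p hp ↦
    Real.log_div hr (Nat.cast_ne_zero.mpr (Nat.prime_of_mem_primesLE hp).ne_zero)

lemma sum_one_add_log_div_eq {r : ℝ} (hr : 1 < r) :
    ∑ p ∈ ⌊r⌋₊.primesLE, (1 + Real.log (r / p)) =
      (Nat.primeCounting ⌊r⌋₊ - Chebyshev.theta r / Real.log r) * (1 + Real.log r) +
        Chebyshev.theta r / Real.log r := by
  have hlog : Real.log r ≠ 0 := (Real.log_pos hr).ne'
  rw [Finset.sum_add_distrib, sum_log_div_eq (by positivity), Finset.sum_const, nsmul_one,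
    Nat.primesLE_card_eq_primeCounting]
  field_simp
  ring

lemma isBigO_sum_one_add_log_div :
    (fun r : ℝ ↦ ∑ p ∈ ⌊r⌋₊.primesLE, (1 + Real.log (r / p))) =O[atTop]
      fun r ↦ r / Real.log r := by
  have htheta : (fun r : ℝ ↦ Chebyshev.theta r / Real.log r) =O[atTop]
      fun r ↦ r / Real.log r := by
    refine .of_bound (Real.log 4) ?_
    filter_upwards [eventually_gt_atTop 1] with r hr
    have hlog := Real.log_pos hr
    rw [Real.norm_of_nonneg (div_nonneg (Chebyshev.theta_nonneg r) hlog.le),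
      Real.norm_of_nonneg (by positivity), ← mul_div_assoc]
    exact div_le_div_of_nonneg_right (Chebyshev.theta_le_log4_mul_x (by positivity)) hlog.le
  have hone : (fun _ ↦ 1 : ℝ → ℝ) =O[atTop] Real.log :=
    (isLittleO_const_left.mpr
      (.inr (tendsto_norm_atTop_atTop.comp Real.tendsto_log_atTop))).isBigO
  have hdiff := (Chebyshev.primeCounting_sub_theta_div_log_isBigO.mul
    (hone.add (isBigO_refl Real.log atTop))).congr' .rfl
      (f₂ := _) (g₂ := fun r ↦ r / Real.log r) <| by
        filter_upwards [eventually_gt_atTop 1] with r hr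
        have := (Real.log_pos hr).ne'
        field_simp
  refine (hdiff.add htheta).congr' ?_ .rfl
  filter_upwards [eventually_gt_atTop 1] with r hr using (sum_one_add_log_div_eq hr).symm

lemma sum_log_div_sq_le {M N : ℕ} (hM : M ≠ 0) (hMN : M ≤ N) :
    ∑ p ∈ Finset.Ioc M N with p.Prime, Real.log p / (p : ℝ) ^ 2 ≤ 2 * Real.log 4 / M := by
  have hlog4 : 0 < Real.log 4 := Real.log_pos (by norm_num)
  -- Partial summation in a form that survives induction on `N`.
  suffices h : ∑ p ∈ Finset.Ioc M N with p.Prime, Real.log p / (p : ℝ) ^ 2 ≤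
      2 * Real.log 4 / M - 2 * Real.log 4 / N + Chebyshev.theta N / N ^ 2 by
    have hN : (0 : ℝ) < N := by exact_mod_cast (Nat.pos_of_ne_zero hM).trans_le hMN
    have htheta : Chebyshev.theta N / (N : ℝ) ^ 2 ≤ 2 * Real.log 4 / N := by
      rw [div_le_div_iff₀ (by positivity) hN]
      nlinarith [Chebyshev.theta_le_log4_mul_x hN.le, mul_pos hlog4 hN]
    linarith
  induction N, hMN using Nat.le_induction with
  | base => simpa using div_nonneg (Chebyshev.theta_nonneg M) (sq_nonneg (M : ℝ))
  | succ N hMN ih =>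
    have hN : (0 : ℝ) < N := by exact_mod_cast (Nat.pos_of_ne_zero hM).trans_le hMN
    have htheta : Chebyshev.theta N / (N : ℝ) ^ 2 - Chebyshev.theta N / ((N + 1 : ℕ) : ℝ) ^ 2 ≤
        2 * Real.log 4 / N - 2 * Real.log 4 / (N + 1 : ℕ) := by
      push_cast
      field_simp
      nlinarith [Chebyshev.theta_le_log4_mul_x hN.le, mul_pos hlog4 hN]
    rw [Finset.sum_filter] at ih ⊢
    rw [Finset.sum_Ioc_succ_top (by omega), Chebyshev.theta_eq_sum_primesLE_log (N + 1),
      sum_primesLE_succ fun p ↦ Real.log p, ← Chebyshev.theta_eq_sum_primesLE_log, add_div]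
    split_ifs with hprime
    · linarith
    · rw [zero_div]
      linarith

lemma sum_inv_sq_le {r : ℝ} (hr : 1 < r) {T : Finset ℕ} (hT : ∀ p ∈ T, p.Prime ∧ r < p) :
    ∑ p ∈ T, 1 / (p : ℝ) ^ 2 ≤ 4 * Real.log 4 / (r * Real.log r) := by
  have hlog := Real.log_pos hr
  have hlog4 : 0 < Real.log 4 := Real.log_pos (by norm_num)
  have hfloor : (1 : ℝ) ≤ ⌊r⌋₊ := by exact_mod_cast Nat.le_floor (by simpa using hr.le)
  have hsub : T ⊆ {p ∈ Finset.Ioc ⌊r⌋₊ (⌊r⌋₊ ⊔ T.sup id) | p.Prime} := fun p hp ↦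
    Finset.mem_filter.mpr ⟨Finset.mem_Ioc.mpr ⟨(Nat.floor_lt (by positivity)).mpr (hT p hp).2,
      le_sup_of_le_right (Finset.le_sup (f := id) hp)⟩, (hT p hp).1⟩
  rw [← div_div, le_div_iff₀ hlog, Finset.sum_mul]
  calc _ ≤ ∑ p ∈ T, Real.log p / (p : ℝ) ^ 2 := Finset.sum_le_sum fun p hp ↦ by
        rw [one_div_mul_eq_div]
        gcongr
        exact (hT p hp).2.le
    _ ≤ _ := Finset.sum_le_sum_of_subset_of_nonneg hsub fun p _ _ ↦
        div_nonneg (Real.log_natCast_nonneg p) (sq_nonneg _)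
    _ ≤ 2 * Real.log 4 / ⌊r⌋₊ := sum_log_div_sq_le (Nat.floor_pos.mpr hr.le).ne' le_sup_left
    _ ≤ _ := by
        rw [div_le_div_iff₀ (by positivity) (by positivity)]
        nlinarith [Nat.lt_floor_add_one r]

lemma sum_rpow_le_div_log {r s : ℝ} (hr : 1 < r) (hs : s < -1) {T : Finset ℕ}
    (hT : ∀ n ∈ T, r < n) :
    ∑ n ∈ T, (n : ℝ) ^ s ≤ (∑' n : ℕ, Real.log n * (n : ℝ) ^ s) / Real.log r := by
  rw [le_div_iff₀ (Real.log_pos hr), Finset.sum_mul]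
  calc _ ≤ ∑ n ∈ T, Real.log n * (n : ℝ) ^ s := Finset.sum_le_sum fun n hn ↦ by
        rw [mul_comm]
        gcongr
        exact (hT n hn).le
    _ ≤ _ := (summable_log_mul_rpow hs).sum_le_tsum _ fun n _ ↦
        mul_nonneg (Real.log_natCast_nonneg n) (by positivity)

lemma sum_image_coe_primes {M : Type*} [AddCommMonoid M] (u : Finset Nat.Primes) (g : ℕ → M) :
    ∑ n ∈ u.image ((↑) : Nat.Primes → ℕ), g n = ∑ p ∈ u, g p :=
  Finset.sum_image fun _ _ _ _ h ↦ Nat.Primes.coe_nat_injective h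

lemma sum_one_add_log_div_le_sum_primesLE {r : ℝ} (hr : 0 ≤ r) {u : Finset Nat.Primes}
    (hu : ∀ p ∈ u, (p : ℝ) ≤ r) :
    ∑ p ∈ u, (1 + Real.log (r / p)) ≤ ∑ p ∈ ⌊r⌋₊.primesLE, (1 + Real.log (r / p)) := by
  rw [← sum_image_coe_primes u fun p ↦ 1 + Real.log (r / p)]
  refine Finset.sum_le_sum_of_subset_of_nonneg (fun n hn ↦ ?_) fun p hp _ ↦ ?_
  · obtain ⟨p, hp, rfl⟩ := Finset.mem_image.mp hn
    exact Nat.mem_primesLE.mpr ⟨Nat.le_floor (hu p hp), p.2⟩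
  · have hp0 : (0 : ℝ) < p := Nat.cast_pos.mpr (Nat.prime_of_mem_primesLE hp).pos
    have hpr := (Nat.le_floor_iff hr).mp (Nat.le_of_mem_primesLE hp)
    linarith [Real.log_nonneg ((one_le_div hp0).mpr hpr)]

lemma sum_inv_sq_add_rpow_le {r s : ℝ} (hr : 1 < r) (hs : s < -1) {u : Finset Nat.Primes}
    (hu : ∀ p ∈ u, r < (p : ℝ)) :
    ∑ p ∈ u, (r ^ 2 * (1 / (p : ℝ) ^ 2) + r * (p : ℝ) ^ s) ≤
      (4 * Real.log 4 + ∑' n : ℕ, Real.log n * (n : ℝ) ^ s) * (r / Real.log r) := by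
  have hlog := Real.log_pos hr
  have hmap : ∀ n ∈ u.image ((↑) : Nat.Primes → ℕ), n.Prime ∧ r < n := by
    intro n hn
    obtain ⟨p, hp, rfl⟩ := Finset.mem_image.mp hn
    exact ⟨p.2, hu p hp⟩
  rw [← sum_image_coe_primes u fun p ↦ r ^ 2 * (1 / (p : ℝ) ^ 2) + r * (p : ℝ) ^ s,
    Finset.sum_add_distrib, ← Finset.mul_sum, ← Finset.mul_sum]
  calc _ ≤ r ^ 2 * (4 * Real.log 4 / (r * Real.log r)) +
        r * ((∑' n : ℕ, Real.log n * (n : ℝ) ^ s) / Real.log r) := by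
        gcongr
        · exact sum_inv_sq_le hr hmap
        · exact sum_rpow_le_div_log hr hs fun n hn ↦ (hmap n hn).2
    _ = _ := by field_simp

lemma isBigO_tsum_primes {f : ℝ → Nat.Primes → ℝ} {A s : ℝ} (hA : 0 ≤ A) (hs : s < -1)
    (hhead : ∀ᶠ r in atTop, ∀ p : Nat.Primes, (p : ℝ) ≤ r → |f r p| ≤ A * (1 + Real.log (r / p)))
    (htail : ∀ᶠ r in atTop, ∀ p : Nat.Primes, r < (p : ℝ) →
      |f r p| ≤ A * (r ^ 2 * (1 / (p : ℝ) ^ 2) + r * (p : ℝ) ^ s)) :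
    (fun r ↦ ∑' p, f r p) =O[atTop] fun r ↦ r / Real.log r := by
  obtain ⟨C, hC⟩ := isBigO_sum_one_add_log_div.bound
  set B := ∑' n : ℕ, Real.log n * (n : ℝ) ^ s
  refine .of_bound (A * C + A * (4 * Real.log 4 + B)) ?_
  filter_upwards [hC, hhead, htail, eventually_gt_atTop 1] with r hC hhead htail hr
  rw [Real.norm_of_nonneg (div_nonneg (by linarith) (Real.log_pos hr).le)] at hC ⊢
  have hsum : ∀ u : Finset Nat.Primes, ∑ p ∈ u, ‖f r p‖ ≤
      (A * C + A * (4 * Real.log 4 + B)) * (r / Real.log r) := by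
    intro u
    rw [← Finset.sum_filter_add_sum_filter_not u fun p ↦ (p : ℝ) ≤ r, add_mul, mul_assoc,
      mul_assoc]
    refine add_le_add
      ((Finset.sum_le_sum fun p hp ↦ hhead p (Finset.mem_filter.mp hp).2).trans ?_)
      ((Finset.sum_le_sum fun p hp ↦ htail p (not_le.mp (Finset.mem_filter.mp hp).2)).trans ?_)
    · rw [← Finset.mul_sum]
      refine mul_le_mul_of_nonneg_left (le_trans ?_ ((le_abs_self _).trans hC)) hA
      exact sum_one_add_log_div_le_sum_primesLE (by linarith) fun p hp ↦
        (Finset.mem_filter.mp hp).2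
    · rw [← Finset.mul_sum]
      exact mul_le_mul_of_nonneg_left (sum_inv_sq_add_rpow_le hr hs fun p hp ↦
        not_le.mp (Finset.mem_filter.mp hp).2) hA
  have hsummable := summable_of_sum_le (fun p ↦ norm_nonneg (f r p)) hsum
  exact (norm_tsum_le_tsum_norm hsummable).trans (hsummable.tsum_le_of_sum_le hsum)

open Polynomial

/-! ### Eigenvalues of symmetric powers -/

lemma exists_upperTriangular_conj (A : Matrix (Fin 2) (Fin 2) ℂ) :
    ∃ (P : (Matrix (Fin 2) (Fin 2) ℂ)ˣ) (α β b : ℂ), A = P * !![α, b; 0, β] * P⁻¹.val := by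
  by_cases hc : A 1 0 = 0
  · refine ⟨1, A 0 0, A 1 1, A 0 1, ?_⟩
    rw [Units.val_one, inv_one, Units.val_one, one_mul, mul_one, ← hc]
    exact A.eta_fin_two
  obtain ⟨s, hs⟩ := IsAlgClosed.exists_eq_mul_self (A.trace ^ 2 - 4 * A.det)
  rw [Matrix.trace_fin_two, Matrix.det_fin_two] at hs
  -- The first column of `P` is an eigenvector for the root `α` of the characteristic polynomial.
  let α := (A 0 0 + A 1 1 + s) / 2
  let P : (Matrix (Fin 2) (Fin 2) ℂ)ˣ := Matrix.GeneralLinearGroup.mkOfDetNeZero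
    !![α - A 1 1, 1; A 1 0, 0] (by simpa [Matrix.det_fin_two] using hc)
  refine ⟨P, α, A 0 0 + A 1 1 - α, 1, ?_⟩
  rw [Units.eq_mul_inv_iff_mul_eq]
  change A * !![α - A 1 1, 1; A 1 0, 0] = !![α - A 1 1, 1; A 1 0, 0] * _
  nth_rw 1 [A.eta_fin_two]
  rw [Matrix.mul_fin_two, Matrix.mul_fin_two]
  simp only [EmbeddingLike.apply_eq_iff_eq, Matrix.vecCons_inj, and_true]
  refine ⟨⟨?_, ?_⟩, ?_, ?_⟩
  · linear_combination (1 / 4) * hs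
  · ring
  · ring
  · ring

lemma symMatrix_upperTriangular_apply (m : ℕ) (α b β : ℂ) (i j : Fin (m + 1)) (hij : j ≤ i) :
    symMatrix m !![α, b; 0, β] i j =
      if i = j then α ^ (m - (j : ℕ)) * β ^ (j : ℕ) else 0 := by
  have hdeg := natDegree_linear_le b β
  have hpoly : symPoly m !![α, b; 0, β] j = Polynomial.C (α ^ (m - (j : ℕ))) *
      (Polynomial.C b + Polynomial.C β * Polynomial.X) ^ (j : ℕ) := by
    simp [symPoly]
  rw [symMatrix, Matrix.of_apply, hpoly, Polynomial.coeff_C_mul]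
  split_ifs with h
  · have hcoeff := Polynomial.coeff_pow_of_natDegree_le (m := (j : ℕ)) hdeg
    rw [mul_one] at hcoeff
    simp [h, hcoeff]
  · rw [Polynomial.coeff_eq_zero_of_natDegree_lt, mul_zero]
    calc _ ≤ (j : ℕ) * 1 := Polynomial.natDegree_pow_le_of_le _ hdeg
      _ < i := by have := Fin.val_ne_of_ne h; have : (j : ℕ) ≤ i := hij; omega

lemma trace_det_symMatrix_upperTriangular (m : ℕ) (α b β : ℂ) :
    (symMatrix m !![α, b; 0, β]).trace = ∑ j ∈ Finset.range (m + 1), α ^ (m - j) * β ^ j ∧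
    ∀ X : ℂ, (1 - X • symMatrix m !![α, b; 0, β]).det =
      ∏ j ∈ Finset.range (m + 1), (1 - X * (α ^ (m - j) * β ^ j)) := by
  have hdiag (j : Fin (m + 1)) := symMatrix_upperTriangular_apply m α b β j j le_rfl
  refine ⟨?_, fun X ↦ ?_⟩
  · rw [Matrix.trace, Finset.sum_range]
    exact Finset.sum_congr rfl fun j _ ↦ by rw [Matrix.diag_apply, hdiag, if_pos rfl]
  · rw [Matrix.det_of_isUpperTriangular, Finset.prod_range]
    · exact Finset.prod_congr rfl fun j _ ↦ by simp [hdiag]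
    · intro i j hji
      have hji : j < i := hji
      simp [symMatrix_upperTriangular_apply m α b β i j hji.le, hji.ne']

lemma exists_eigenvalues_symMatrix (A : Matrix (Fin 2) (Fin 2) ℂ) :
    ∃ α β : ℂ, α * β = A.det ∧ α + β = A.trace ∧ ∀ m : ℕ,
      (symMatrix m A).trace = ∑ j ∈ Finset.range (m + 1), α ^ (m - j) * β ^ j ∧
      ∀ X : ℂ, (1 - X • symMatrix m A).det =
        ∏ j ∈ Finset.range (m + 1), (1 - X * (α ^ (m - j) * β ^ j)) := by
  obtain ⟨P, α, β, b, rfl⟩ := exists_upperTriangular_conj A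
  refine ⟨α, β, ?_, ?_, fun m ↦ ?_⟩
  · rw [Matrix.det_units_conj, Matrix.det_fin_two_of, mul_zero, sub_zero]
  · rw [Matrix.trace_units_conj, Matrix.trace_fin_two_of]
  have hinv : symMatrix m P * symMatrix m P⁻¹.val = 1 := by
    rw [← symMatrix_mul, Units.mul_inv, symMatrix_one]
  obtain ⟨htrace, hdet⟩ := trace_det_symMatrix_upperTriangular m α b β
  rw [symMatrix_mul, symMatrix_mul]
  refine ⟨?_, fun X ↦ ?_⟩
  · rw [Matrix.trace_mul_comm, ← mul_assoc, mul_eq_one_comm.mp hinv, one_mul, htrace]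
  · rw [← hdet, ← Matrix.det_conj_of_mul_eq_one (N := 1 - X • symMatrix m !![α, b; 0, β]) hinv
      (mul_eq_one_comm.mp hinv), Matrix.mul_sub, Matrix.sub_mul, mul_one, hinv,
      Matrix.mul_smul, Matrix.smul_mul]

/-! ### Traces, characters and characteristic polynomials on `SU(2)` -/

lemma conjTranspose_eq_adjugate (g : SU2) :
    (g : Matrix (Fin 2) (Fin 2) ℂ).conjTranspose = (g : Matrix (Fin 2) (Fin 2) ℂ).adjugate := by
  obtain ⟨hunitary, hdet⟩ := Matrix.mem_specialUnitaryGroup_iff.mp g.2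
  have hstar : star (g : Matrix (Fin 2) (Fin 2) ℂ) * g = 1 :=
    Matrix.mem_unitaryGroup_iff'.mp hunitary
  refine left_inv_eq_right_inv hstar ?_
  rw [Matrix.mul_adjugate, hdet, one_smul]

lemma coe_one_one (g : SU2) :
    (g : Matrix (Fin 2) (Fin 2) ℂ) 1 1 = star ((g : Matrix (Fin 2) (Fin 2) ℂ) 0 0) := by
  have h := congrFun (congrFun (conjTranspose_eq_adjugate g) 0) 0
  rw [Matrix.conjTranspose_apply, Matrix.adjugate_fin_two] at h
  simpa using h.symm

lemma norm_coe_le_one (g : SU2) (i j : Fin 2) : ‖(g : Matrix (Fin 2) (Fin 2) ℂ) i j‖ ≤ 1 :=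
  entry_norm_bound_of_unitary (Matrix.specialUnitaryGroup_le_unitaryGroup g.2) i j

/-- The trace of an element of `SU(2)`, as a real number. The second diagonal entry of `g` is the
conjugate of the first one. -/
noncomputable def tr (g : SU2) : ℝ := 2 * ((g : Matrix (Fin 2) (Fin 2) ℂ) 0 0).re

lemma trace_coe (g : SU2) : (g : Matrix (Fin 2) (Fin 2) ℂ).trace = (tr g : ℂ) := by
  rw [Matrix.trace_fin_two, coe_one_one, Complex.star_def, Complex.add_conj, tr]

lemma continuous_tr : Continuous tr :=
  continuous_const.mul (Complex.continuous_re.comp (continuous_subtype_val.matrix_elem 0 0))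

lemma abs_tr_le (g : SU2) : |tr g| ≤ 2 := by
  have hre := (Complex.abs_re_le_norm _).trans (norm_coe_le_one g 0 0)
  rw [tr, abs_mul, abs_two]
  linarith

lemma chebyshevS_add_two (R : Type*) [CommRing R] (k : ℤ) :
    Chebyshev.S R (k + 2) = Chebyshev.S R k + Chebyshev.C R (k + 2) := by
  have h := Chebyshev.C_eq_S_sub_X_mul_S R (k + 2)
  rw [Chebyshev.S_add_two] at h ⊢
  rw [add_sub_assoc, show (2 : ℤ) - 1 = 1 by norm_num] at h
  rw [h]
  ring

lemma prod_range_pow_mul_pow_add_two {R M : Type*} [CommRing R] [CommMonoid M] {α β : R}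
    (hαβ : α * β = 1) (f : R → M) (m : ℕ) :
    ∏ j ∈ Finset.range (m + 3), f (α ^ (m + 2 - j) * β ^ j) =
      (∏ j ∈ Finset.range (m + 1), f (α ^ (m - j) * β ^ j)) *
        (f (α ^ (m + 2)) * f (β ^ (m + 2))) := by
  have hinner : ∀ j ∈ Finset.range (m + 1),
      f (α ^ (m + 2 - (j + 1)) * β ^ (j + 1)) = f (α ^ (m - j) * β ^ j) := fun j hj ↦ by
    have hexp : m + 2 - (j + 1) = m - j + 1 := by have := Finset.mem_range.mp hj; omega
    rw [hexp, pow_succ, pow_succ', mul_assoc, ← mul_assoc α, hαβ, one_mul]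
  rw [Finset.prod_range_succ, Finset.prod_range_succ', Finset.prod_congr rfl hinner]
  simp [mul_assoc]

lemma pow_add_pow_eq_eval_chebyshevC {R : Type*} [CommRing R] {α β : R} (hαβ : α * β = 1)
    (m : ℕ) : α ^ m + β ^ m = (Chebyshev.C R m).eval (α + β) := by
  induction m using Nat.twoStepInduction with
  | zero => simp [one_add_one_eq_two]
  | one => simp
  | more m ih₀ ih₁ =>
    push_cast at ih₁ ⊢
    rw [Chebyshev.C_add_two, Polynomial.eval_sub, Polynomial.eval_mul,
      Polynomial.eval_X, ← ih₀, ← ih₁]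
    linear_combination (-α ^ m - β ^ m) * hαβ

lemma sum_range_pow_mul_pow_eq_eval_chebyshevS {R : Type*} [CommRing R] {α β : R}
    (hαβ : α * β = 1) (m : ℕ) :
    ∑ j ∈ Finset.range (m + 1), α ^ (m - j) * β ^ j = (Chebyshev.S R m).eval (α + β) := by
  induction m using Nat.twoStepInduction with
  | zero => simp
  | one => simp [Finset.sum_range_succ]
  | more m ih _ =>
    have hC := pow_add_pow_eq_eval_chebyshevC hαβ (m + 2)
    have hsplit := prod_range_pow_mul_pow_add_two hαβ Multiplicative.ofAdd m
    push_cast at hC ⊢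
    rw [chebyshevS_add_two, Polynomial.eval_add, ← ih, ← hC]
    exact hsplit

lemma exists_eigenvalues_sym (g : SU2) : ∃ α β : ℂ, α * β = 1 ∧ α + β = tr g ∧ ∀ m : ℕ,
    character (sym m) g = ∑ j ∈ Finset.range (m + 1), α ^ (m - j) * β ^ j ∧
    ∀ X : ℂ, eulerD X (sym m) g =
      (∏ j ∈ Finset.range (m + 1), (1 - X * (α ^ (m - j) * β ^ j)))⁻¹ := by
  obtain ⟨α, β, hdet, htrace, h⟩ := exists_eigenvalues_symMatrix g
  exact ⟨α, β, hdet.trans (Matrix.mem_specialUnitaryGroup_iff.mp g.2).2,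
    htrace.trans (trace_coe g), fun m ↦ ⟨(h m).1, fun X ↦ congrArg _ ((h m).2 X)⟩⟩

lemma character_sym (m : ℕ) (g : SU2) :
    character (sym m) g = ((Chebyshev.S ℝ m).eval (tr g) : ℝ) := by
  obtain ⟨α, β, hαβ, htr, h⟩ := exists_eigenvalues_sym g
  rw [(h m).1, sum_range_pow_mul_pow_eq_eval_chebyshevS hαβ, htr,
    Chebyshev.complex_ofReal_eval_S]

/-- The quadratic `(1 - X α) (1 - X β)`, where `α β = 1` and `α + β = t`. -/
noncomputable def quad (X t : ℝ) : ℝ := 1 - t * X + X ^ 2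

lemma ofReal_quad {X t : ℝ} {α β : ℂ} (hαβ : α * β = 1) (ht : α + β = t) :
    (quad X t : ℂ) = (1 - X * α) * (1 - X * β) := by
  rw [quad]
  push_cast
  rw [← ht]
  linear_combination (-(X : ℂ) ^ 2) * hαβ

/-- The polynomial `det (1 - X sym^m g)` as a function of `X` and of `t = tr g`. The eigenvalues
of `sym^(m + 2) g` are those of `sym^m g` and the extreme pair `α ^ (m + 2)`, `β ^ (m + 2)`, whose
sum is a Chebyshev polynomial in `t`. -/
noncomputable def symDet : ℕ → ℝ → ℝ → ℝ
  | 0, X, _ => 1 - X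
  | 1, X, t => quad X t
  | m + 2, X, t => symDet m X t * quad X ((Chebyshev.C ℝ (m + 2)).eval t)

lemma ofReal_symDet {X t : ℝ} {α β : ℂ} (hαβ : α * β = 1) (ht : α + β = t) (m : ℕ) :
    (symDet m X t : ℂ) = ∏ j ∈ Finset.range (m + 1), (1 - X * (α ^ (m - j) * β ^ j)) := by
  induction m using Nat.twoStepInduction with
  | zero => simp [symDet]
  | one => simp [symDet, ofReal_quad hαβ ht, Finset.prod_range_succ]
  | more m ih _ =>
    have hC := pow_add_pow_eq_eval_chebyshevC hαβ (m + 2)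
    rw [ht, ← Chebyshev.complex_ofReal_eval_C] at hC
    norm_num only [Nat.cast_add, Nat.cast_ofNat] at hC
    have hpow : α ^ (m + 2) * β ^ (m + 2) = 1 := by rw [← mul_pow, hαβ, one_pow]
    rw [symDet, Complex.ofReal_mul, ih, ofReal_quad hpow hC,
      prod_range_pow_mul_pow_add_two hαβ fun x : ℂ ↦ 1 - X * x]

lemma eulerD_sym (m : ℕ) (X : ℝ) (g : SU2) :
    eulerD X (sym m) g = ((symDet m X (tr g))⁻¹ : ℝ) := by
  obtain ⟨α, β, hαβ, htr, h⟩ := exists_eigenvalues_sym g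
  rw [(h m).2, ← ofReal_symDet hαβ htr, Complex.ofReal_inv]

lemma eulerD_st (X : ℝ) (g : SU2) : eulerD X st g = ((symDet 1 X (tr g))⁻¹ : ℝ) := by
  have hdet := (Matrix.mem_specialUnitaryGroup_iff.mp g.2).2
  have htr := trace_coe g
  rw [Matrix.trace_fin_two] at htr
  rw [Matrix.det_fin_two] at hdet
  rw [eulerD, Complex.ofReal_inv, symDet, quad, Matrix.det_fin_two]
  push_cast
  rw [← htr]
  congr 1
  simp only [st, Submonoid.subtype_apply, Matrix.sub_apply, Matrix.one_apply_eq, Matrix.smul_apply,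
    smul_eq_mul, ne_eq, zero_ne_one, one_ne_zero, not_false_eq_true, Matrix.one_apply_ne]
  linear_combination (X : ℂ) ^ 2 * hdet

/-! ### Estimates for the characteristic polynomials -/

lemma abs_eval_chebyshevC_le {t : ℝ} (ht : |t| ≤ 2) (k : ℤ) :
    |(Chebyshev.C ℝ k).eval t| ≤ 2 := by
  obtain ⟨hl, hu⟩ := abs_le.mp ht
  have hcos : t = 2 * Real.cos (Real.arccos (t / 2)) := by
    rw [Real.cos_arccos (by linarith) (by linarith), mul_div_cancel₀ t two_ne_zero]
  rw [hcos, Chebyshev.C_two_mul_real_cos, abs_mul, abs_two]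
  exact mul_le_of_le_one_right zero_le_two (Real.abs_cos_le_one _)

lemma abs_eval_chebyshevS_le {t : ℝ} (ht : |t| ≤ 2) (m : ℕ) :
    |(Chebyshev.S ℝ m).eval t| ≤ m + 1 := by
  induction m using Nat.twoStepInduction with
  | zero => simp
  | one => norm_num [ht]
  | more m ih _ =>
    push_cast
    rw [chebyshevS_add_two, eval_add]
    linarith [abs_add_le ((Chebyshev.S ℝ m).eval t) ((Chebyshev.C ℝ (m + 2)).eval t),
      abs_eval_chebyshevC_le ht (m + 2)]

lemma exists_abs_eval_sub_eval_le (P : ℝ[X]) (a b : ℝ) : ∃ K, 0 ≤ K ∧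
    ∀ t ∈ Set.Icc a b, ∀ t' ∈ Set.Icc a b, |P.eval t - P.eval t'| ≤ K * |t - t'| := by
  have hP : ContDiff ℝ 1 (P.eval ·) := P.contDiff_aeval 1
  obtain ⟨K, hK⟩ := hP.locallyLipschitz.locallyLipschitzOn
    |>.exists_lipschitzOnWith_of_compact (isCompact_Icc (a := a) (b := b))
  refine ⟨K, K.2, fun t ht t' ht' ↦ ?_⟩
  have h := hK.dist_le_mul t ht t' ht'
  rwa [Real.dist_eq, Real.dist_eq] at h

lemma sq_one_sub_le_quad {X t : ℝ} (hX : 0 ≤ X) (ht : |t| ≤ 2) : (1 - X) ^ 2 ≤ quad X t := by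
  have := mul_le_mul_of_nonneg_right (abs_le.mp ht).2 hX
  rw [quad]
  linarith

lemma quad_le_sq_one_add {X t : ℝ} (hX : 0 ≤ X) (ht : |t| ≤ 2) : quad X t ≤ (1 + X) ^ 2 := by
  have := mul_le_mul_of_nonneg_right (abs_le.mp ht).1 hX
  rw [quad]
  linarith

lemma one_sub_pow_le_symDet {X t : ℝ} (h₀ : 0 ≤ X) (h₁ : X ≤ 1) (ht : |t| ≤ 2) (m : ℕ) :
    (1 - X) ^ (m + 1) ≤ symDet m X t := by
  have hX : 0 ≤ 1 - X := sub_nonneg.mpr h₁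
  induction m using Nat.twoStepInduction with
  | zero => simp [symDet]
  | one => exact sq_one_sub_le_quad h₀ ht
  | more m ih _ =>
    rw [symDet, show m + 2 + 1 = m + 1 + 2 by ring, pow_add]
    exact mul_le_mul ih (sq_one_sub_le_quad h₀ (abs_eval_chebyshevC_le ht _)) (by positivity)
      ((pow_nonneg hX _).trans ih)

lemma symDet_le_one_add_pow {X t : ℝ} (h₀ : 0 ≤ X) (ht : |t| ≤ 2) (m : ℕ) :
    symDet m X t ≤ (1 + X) ^ (m + 1) := by
  induction m using Nat.twoStepInduction with
  | zero => simp only [symDet, zero_add, pow_one]; linarith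
  | one => exact quad_le_sq_one_add h₀ ht
  | more m ih _ =>
    have hC := abs_eval_chebyshevC_le ht (m + 2)
    rw [symDet, show m + 2 + 1 = m + 1 + 2 by ring, pow_add]
    exact mul_le_mul ih (quad_le_sq_one_add h₀ hC)
      ((sq_nonneg _).trans (sq_one_sub_le_quad h₀ hC)) (by positivity)

lemma abs_symDet_le {X t : ℝ} (h₀ : 0 ≤ X) (h₁ : X ≤ 1) (ht : |t| ≤ 2) (m : ℕ) :
    |symDet m X t| ≤ 2 ^ (m + 1) := by
  have hnonneg : 0 ≤ symDet m X t :=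
    (pow_nonneg (sub_nonneg.mpr h₁) _).trans (one_sub_pow_le_symDet h₀ h₁ ht m)
  rw [abs_of_nonneg hnonneg]
  exact (symDet_le_one_add_pow h₀ ht m).trans (pow_le_pow_left₀ (by positivity) (by linarith) _)

lemma continuous_symDet (m : ℕ) (X : ℝ) : Continuous (symDet m X) := by
  induction m using Nat.twoStepInduction with
  | zero => exact continuous_const
  | one => simp only [symDet, quad]; fun_prop
  | more m ih _ => simp only [symDet, quad]; fun_prop

lemma abs_quad_le_four {X t : ℝ} (h₀ : 0 ≤ X) (h₁ : X ≤ 1) (ht : |t| ≤ 2) : |quad X t| ≤ 4 :=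
  (abs_symDet_le h₀ h₁ ht 1).trans (by norm_num)

lemma exists_abs_symDet_sub_le (m : ℕ) : ∃ K, 0 ≤ K ∧ ∀ X t : ℝ, 0 ≤ X → X ≤ 1 → |t| ≤ 2 →
    |symDet m X t - (1 - (Chebyshev.S ℝ m).eval t * X)| ≤ K * X ^ 2 := by
  induction m using Nat.twoStepInduction with
  | zero => exact ⟨0, le_rfl, fun X t _ _ _ ↦ by simp [symDet]⟩
  | one => exact ⟨1, zero_le_one, fun X t _ _ _ ↦ by simp [symDet, quad]⟩
  | more m ih _ =>
    obtain ⟨K, hK, ih⟩ := ih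
    refine ⟨K * 4 + 1 + (m + 1) * 3, by positivity, fun X t h₀ h₁ ht ↦ ?_⟩
    set u := (Chebyshev.S ℝ m).eval t
    set v := (Chebyshev.C ℝ (m + 2)).eval t
    have hv₂ : |v| ≤ 2 := abs_eval_chebyshevC_le ht _
    have hS : (Chebyshev.S ℝ (m + 2 : ℕ)).eval t = u + v := by
      push_cast
      rw [chebyshevS_add_two, eval_add]
    have hdecomp : symDet m X t * quad X v - (1 - (u + v) * X) =
        (symDet m X t - (1 - u * X)) * quad X v + X ^ 2 + u * (v - X) * X ^ 2 := by
      rw [quad]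
      ring
    have hmain : |(symDet m X t - (1 - u * X)) * quad X v| ≤ K * X ^ 2 * 4 := by
      rw [abs_mul]
      exact mul_le_mul (ih X t h₀ h₁ ht) (abs_quad_le_four h₀ h₁ hv₂) (abs_nonneg _)
        (by positivity)
    have hcross : |u * (v - X) * X ^ 2| ≤ (m + 1) * 3 * X ^ 2 := by
      rw [abs_mul, abs_mul, abs_of_nonneg (sq_nonneg X)]
      refine mul_le_mul_of_nonneg_right (mul_le_mul (abs_eval_chebyshevS_le ht m) ?_
        (abs_nonneg _) (by positivity)) (sq_nonneg X)
      exact (abs_sub _ _).trans (by rw [abs_of_nonneg h₀]; linarith)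
    rw [hS, symDet, hdecomp]
    refine (abs_add_three _ _ _).trans ?_
    rw [abs_of_nonneg (sq_nonneg X)]
    linarith

lemma exists_abs_symDet_sub_symDet_le (m : ℕ) : ∃ K, 0 ≤ K ∧ ∀ X t t' : ℝ, 0 ≤ X → X ≤ 1 →
    |t| ≤ 2 → |t'| ≤ 2 → |symDet m X t - symDet m X t'| ≤ K * X * |t - t'| := by
  have hquad (X u v : ℝ) : quad X u - quad X v = -(X * (u - v)) := by rw [quad, quad]; ring
  induction m using Nat.twoStepInduction with
  | zero => exact ⟨0, le_rfl, fun X t t' _ _ _ _ ↦ by simp [symDet]⟩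
  | one =>
    refine ⟨1, zero_le_one, fun X t t' h₀ _ _ _ ↦ ?_⟩
    rw [symDet, symDet, hquad, abs_neg, abs_mul, abs_of_nonneg h₀, one_mul]
  | more m ih _ =>
    obtain ⟨K, hK, ih⟩ := ih
    obtain ⟨L, hL, hlip⟩ := exists_abs_eval_sub_eval_le (Chebyshev.C ℝ (m + 2)) (-2) 2
    refine ⟨K * 4 + 2 ^ (m + 1) * L, by positivity, fun X t t' h₀ h₁ ht ht' ↦ ?_⟩
    rw [symDet, symDet]
    set v := (Chebyshev.C ℝ (m + 2)).eval t
    set v' := (Chebyshev.C ℝ (m + 2)).eval t'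
    have hdecomp : symDet m X t * quad X v - symDet m X t' * quad X v' =
        (symDet m X t - symDet m X t') * quad X v + symDet m X t' * (quad X v - quad X v') := by
      ring
    have hsym : |(symDet m X t - symDet m X t') * quad X v| ≤ K * X * |t - t'| * 4 := by
      rw [abs_mul]
      exact mul_le_mul (ih X t t' h₀ h₁ ht ht')
        (abs_quad_le_four h₀ h₁ (abs_eval_chebyshevC_le ht _)) (abs_nonneg _) (by positivity)
    have hlast : |symDet m X t' * (quad X v - quad X v')| ≤
        2 ^ (m + 1) * (X * (L * |t - t'|)) := by
      rw [hquad, abs_mul, abs_neg, abs_mul, abs_of_nonneg h₀]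
      have hv := hlip t (abs_le.mp ht) t' (abs_le.mp ht')
      exact mul_le_mul (abs_symDet_le h₀ h₁ ht' m) (mul_le_mul_of_nonneg_left hv h₀)
        (by positivity) (by positivity)
    rw [hdecomp]
    exact (abs_add_le _ _).trans (by linarith)

lemma abs_inv_sub_two_sub_le {c y : ℝ} (hc : 0 < c) (hy : c ≤ y) :
    |y⁻¹ - (2 - y)| ≤ (y - 1) ^ 2 / c := by
  have hpos : 0 < y := hc.trans_le hy
  have h : y⁻¹ - (2 - y) = (y - 1) ^ 2 / y := by field_simp; ring
  rw [h, abs_of_nonneg (by positivity)]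
  gcongr

lemma abs_log_sub_sub_one_le {c y : ℝ} (hc : 0 < c) (hy : c ≤ y) :
    |Real.log y - (y - 1)| ≤ (y - 1) ^ 2 / c := by
  have hpos : 0 < y := hc.trans_le hy
  have hinv := abs_le.mp (abs_inv_sub_two_sub_le hc hy)
  have hle := Real.log_le_sub_one_of_pos hpos
  have hge := Real.one_sub_inv_le_log_of_pos hpos
  rw [abs_le]
  constructor <;> linarith

lemma abs_log_sub_log_le {c a b : ℝ} (hc : 0 < c) (ha : c ≤ a) (hb : c ≤ b) :
    |Real.log a - Real.log b| ≤ |a - b| / c := by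
  wlog hab : b ≤ a generalizing a b
  · rw [abs_sub_comm, abs_sub_comm a]
    exact this hb ha (not_le.mp hab).le
  have hb₀ : 0 < b := hc.trans_le hb
  rw [abs_of_nonneg (sub_nonneg.mpr (Real.log_le_log hb₀ hab)), abs_of_nonneg (sub_nonneg.mpr hab)]
  exact (log_sub_log_le_div hb₀ (hc.trans_le ha)).trans
    (div_le_div_of_nonneg_left (sub_nonneg.mpr hab) hc hb)

lemma quarter_pow_le_symDet {X t : ℝ} (h₀ : 0 ≤ X) (h₁ : X ≤ 3 / 4) (ht : |t| ≤ 2) (m : ℕ) :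
    (1 / 4) ^ (m + 1) ≤ symDet m X t :=
  (pow_le_pow_left₀ (by norm_num) (by linarith) _).trans
    (one_sub_pow_le_symDet h₀ (by linarith) ht m)

lemma symDet_pos {X t : ℝ} (h₀ : 0 ≤ X) (h₁ : X ≤ 3 / 4) (ht : |t| ≤ 2) (m : ℕ) :
    0 < symDet m X t :=
  (by positivity : (0 : ℝ) < (1 / 4) ^ (m + 1)).trans_le (quarter_pow_le_symDet h₀ h₁ ht m)

lemma exists_abs_symDet_sub_one_le (m : ℕ) : ∃ K, 0 ≤ K ∧ ∀ X t : ℝ, 0 ≤ X → X ≤ 1 → |t| ≤ 2 →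
    |symDet m X t - 1| ≤ K * X := by
  obtain ⟨K, hK, h⟩ := exists_abs_symDet_sub_le m
  refine ⟨K + (m + 1), by positivity, fun X t h₀ h₁ ht ↦ ?_⟩
  have hS : |(Chebyshev.S ℝ m).eval t * X| ≤ (m + 1) * X := by
    rw [abs_mul, abs_of_nonneg h₀]
    exact mul_le_mul_of_nonneg_right (abs_eval_chebyshevS_le ht m) h₀
  have hsq : K * X ^ 2 ≤ K * X := mul_le_mul_of_nonneg_left (by nlinarith) hK
  calc |symDet m X t - 1|
      = |symDet m X t - (1 - (Chebyshev.S ℝ m).eval t * X) - (Chebyshev.S ℝ m).eval t * X| := by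
        congr 1; ring
    _ ≤ _ := abs_sub _ _
    _ ≤ (K + (m + 1)) * X := by linarith [h X t h₀ h₁ ht]

lemma exists_sq_symDet_sub_one_le (m : ℕ) : ∃ K, 0 ≤ K ∧ ∀ X t : ℝ, 0 ≤ X → X ≤ 1 → |t| ≤ 2 →
    (symDet m X t - 1) ^ 2 ≤ K * X ^ 2 := by
  obtain ⟨K, -, h⟩ := exists_abs_symDet_sub_one_le m
  refine ⟨K ^ 2, by positivity, fun X t h₀ h₁ ht ↦ ?_⟩
  rw [← sq_abs, ← mul_pow]
  exact pow_le_pow_left₀ (abs_nonneg _) (h X t h₀ h₁ ht) 2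

lemma exists_abs_log_symDet_add_le (m : ℕ) : ∃ K, 0 ≤ K ∧ ∀ X t : ℝ, 0 ≤ X → X ≤ 3 / 4 →
    |t| ≤ 2 → |Real.log (symDet m X t) + (Chebyshev.S ℝ m).eval t * X| ≤ K * X ^ 2 := by
  obtain ⟨K, hK, hlin⟩ := exists_abs_symDet_sub_le m
  obtain ⟨K', hK', hsq⟩ := exists_sq_symDet_sub_one_le m
  refine ⟨K' / (1 / 4) ^ (m + 1) + K, by positivity, fun X t h₀ h₁ ht ↦ ?_⟩
  have hlog : |Real.log (symDet m X t) - (symDet m X t - 1)| ≤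
      K' * X ^ 2 / (1 / 4) ^ (m + 1) :=
    (abs_log_sub_sub_one_le (by positivity) (quarter_pow_le_symDet h₀ h₁ ht m)).trans
      (div_le_div_of_nonneg_right (hsq X t h₀ (by linarith) ht) (by positivity))
  have h := abs_add_le (Real.log (symDet m X t) - (symDet m X t - 1))
    (symDet m X t - (1 - (Chebyshev.S ℝ m).eval t * X))
  rw [add_mul, div_mul_eq_mul_div]
  refine (le_of_eq (congrArg _ (by ring))).trans (h.trans ?_)
  exact add_le_add hlog (hlin X t h₀ (by linarith) ht)

lemma exists_abs_log_symDet_sub_log_symDet_le (m : ℕ) : ∃ K, 0 ≤ K ∧ ∀ X t t' : ℝ, 0 ≤ X →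
    X ≤ 3 / 4 → |t| ≤ 2 → |t'| ≤ 2 →
    |Real.log (symDet m X t) - Real.log (symDet m X t')| ≤ K * X * |t - t'| := by
  obtain ⟨K, hK, hlip⟩ := exists_abs_symDet_sub_symDet_le m
  refine ⟨K / (1 / 4) ^ (m + 1), by positivity, fun X t t' h₀ h₁ ht ht' ↦ ?_⟩
  rw [div_mul_eq_mul_div, div_mul_eq_mul_div]
  exact (abs_log_sub_log_le (by positivity) (quarter_pow_le_symDet h₀ h₁ ht m)
    (quarter_pow_le_symDet h₀ h₁ ht' m)).trans
    (div_le_div_of_nonneg_right (hlip X t t' h₀ (by linarith) ht ht') (by positivity))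

lemma exists_abs_inv_symDet_sub_one_le (m : ℕ) : ∃ K, 0 ≤ K ∧ ∀ X t : ℝ, 0 ≤ X → X ≤ 3 / 4 →
    |t| ≤ 2 → |(symDet m X t)⁻¹ - 1| ≤ K * X := by
  obtain ⟨K, hK, h⟩ := exists_abs_symDet_sub_one_le m
  refine ⟨K / (1 / 4) ^ (m + 1), by positivity, fun X t h₀ h₁ ht ↦ ?_⟩
  have hpos := symDet_pos h₀ h₁ ht m
  have hinv : (symDet m X t)⁻¹ - 1 = -(symDet m X t - 1) / symDet m X t := by field_simp; ring
  rw [hinv, abs_div, abs_neg, abs_of_pos hpos, div_mul_eq_mul_div]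
  exact div_le_div₀ (by positivity) (h X t h₀ (by linarith) ht) (by positivity)
    (quarter_pow_le_symDet h₀ h₁ ht m)

lemma exists_abs_inv_symDet_sub_le (m : ℕ) : ∃ K, 0 ≤ K ∧ ∀ X t : ℝ, 0 ≤ X → X ≤ 3 / 4 →
    |t| ≤ 2 → |(symDet m X t)⁻¹ - (1 + (Chebyshev.S ℝ m).eval t * X)| ≤ K * X ^ 2 := by
  obtain ⟨K, hK, hlin⟩ := exists_abs_symDet_sub_le m
  obtain ⟨K', hK', hsq⟩ := exists_sq_symDet_sub_one_le m
  refine ⟨K' / (1 / 4) ^ (m + 1) + K, by positivity, fun X t h₀ h₁ ht ↦ ?_⟩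
  have hinv : |(symDet m X t)⁻¹ - (2 - symDet m X t)| ≤ K' * X ^ 2 / (1 / 4) ^ (m + 1) :=
    (abs_inv_sub_two_sub_le (by positivity) (quarter_pow_le_symDet h₀ h₁ ht m)).trans
      (div_le_div_of_nonneg_right (hsq X t h₀ (by linarith) ht) (by positivity))
  have h := abs_sub ((symDet m X t)⁻¹ - (2 - symDet m X t))
    (symDet m X t - (1 - (Chebyshev.S ℝ m).eval t * X))
  rw [add_mul, div_mul_eq_mul_div]
  refine (le_of_eq (congrArg _ (by ring))).trans (h.trans ?_)
  exact add_le_add hinv (hlin X t h₀ (by linarith) ht)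

lemma quad_mul_sum_eval_chebyshevS (X t : ℝ) (n : ℕ) :
    quad X t * ∑ k ∈ Finset.range (n + 1), (Chebyshev.S ℝ k).eval t * X ^ k =
      1 - (Chebyshev.S ℝ (n + 1)).eval t * X ^ (n + 1) +
        (Chebyshev.S ℝ n).eval t * X ^ (n + 2) := by
  induction n with
  | zero => simp [quad]
  | succ n ih =>
    rw [Finset.sum_range_succ, mul_add, ih]
    push_cast
    rw [show (n : ℤ) + 1 + 1 = n + 2 by ring, Chebyshev.S_add_two, eval_sub, eval_mul, eval_X,
      quad]
    ring

lemma abs_inv_quad_sub_sum_le {X t : ℝ} (h₀ : 0 ≤ X) (h₁ : X ≤ 3 / 4) (ht : |t| ≤ 2) (n : ℕ) :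
    |(quad X t)⁻¹ - ∑ k ∈ Finset.range (n + 1), (Chebyshev.S ℝ k).eval t * X ^ k| ≤
      16 * (2 * n + 3) * X ^ (n + 1) := by
  have hquad : 1 / 16 ≤ quad X t := by
    calc (1 / 16 : ℝ) = (1 / 4) ^ (1 + 1) := by norm_num
      _ ≤ symDet 1 X t := quarter_pow_le_symDet h₀ h₁ ht 1
  have hpos : 0 < quad X t := by linarith
  have hS₁ := abs_eval_chebyshevS_le ht (n + 1)
  have hS₀ := abs_eval_chebyshevS_le ht n
  push_cast at hS₁
  have hdiff : (quad X t)⁻¹ - ∑ k ∈ Finset.range (n + 1), (Chebyshev.S ℝ k).eval t * X ^ k =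
      X ^ (n + 1) * ((Chebyshev.S ℝ (n + 1)).eval t - (Chebyshev.S ℝ n).eval t * X) /
        quad X t := by
    rw [eq_div_iff hpos.ne', sub_mul, inv_mul_cancel₀ hpos.ne', mul_comm _ (quad X t),
      quad_mul_sum_eval_chebyshevS]
    ring
  have hnum : |(Chebyshev.S ℝ (n + 1)).eval t - (Chebyshev.S ℝ n).eval t * X| ≤ 2 * n + 3 := by
    have hX : |(Chebyshev.S ℝ n).eval t * X| ≤ n + 1 := by
      rw [abs_mul, abs_of_nonneg h₀]
      exact (mul_le_of_le_one_right (abs_nonneg _) (by linarith)).trans hS₀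
    exact (abs_sub _ _).trans (by linarith)
  rw [hdiff, abs_div, abs_of_pos hpos, div_le_iff₀ hpos, abs_mul, abs_of_nonneg (by positivity)]
  calc X ^ (n + 1) * _ ≤ X ^ (n + 1) * (2 * n + 3) * (16 * quad X t) := by
        refine (mul_le_mul_of_nonneg_left hnum (by positivity)).trans ?_
        exact le_mul_of_one_le_right (by positivity) (by linarith)
    _ = _ := by ring

/-! ### Invariant vectors and integrals over `SU(2)` -/

open scoped Matrix

instance instIsMulLeftInvariantHaarSU2 : haarSU2.IsMulLeftInvariant := by
  unfold haarSU2; infer_instance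

instance instIsProbabilityMeasureHaarSU2 : IsProbabilityMeasure haarSU2 := by
  refine ⟨?_⟩
  have h := Measure.haarMeasure_self (K₀ := (⊤ : TopologicalSpace.PositiveCompacts SU2))
  rwa [TopologicalSpace.PositiveCompacts.coe_top] at h

lemma integrable_of_continuous {E : Type*} [NormedAddCommGroup E] {f : SU2 → E}
    (hf : Continuous f) : Integrable f haarSU2 :=
  hf.integrable_of_hasCompactSupport (HasCompactSupport.of_compactSpace f)

lemma continuous_coeff_mul {T R : Type*} [TopologicalSpace T] [Semiring R] [TopologicalSpace R]
    [IsTopologicalSemiring R] {P Q : T → R[X]} (hP : ∀ i, Continuous fun x ↦ (P x).coeff i)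
    (hQ : ∀ i, Continuous fun x ↦ (Q x).coeff i) (i : ℕ) :
    Continuous fun x ↦ (P x * Q x).coeff i := by
  simp only [Polynomial.coeff_mul]
  fun_prop

lemma continuous_coeff_pow {T R : Type*} [TopologicalSpace T] [Semiring R] [TopologicalSpace R]
    [IsTopologicalSemiring R] {P : T → R[X]} (hP : ∀ i, Continuous fun x ↦ (P x).coeff i)
    (k i : ℕ) : Continuous fun x ↦ (P x ^ k).coeff i := by
  induction k generalizing i with
  | zero => simpa only [pow_zero] using continuous_const
  | succ k ih => simpa only [pow_succ] using continuous_coeff_mul ih hP i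

lemma continuous_symMatrix (m : ℕ) : Continuous (symMatrix m) := by
  have hlin (k : Fin 2) (i : ℕ) : Continuous fun A : Matrix (Fin 2) (Fin 2) ℂ ↦
      (Polynomial.C (A 0 k) + Polynomial.C (A 1 k) * X).coeff i := by
    simp only [Polynomial.coeff_add, Polynomial.coeff_C_mul, Polynomial.coeff_C]
    split_ifs <;> fun_prop
  exact continuous_matrix fun i j ↦ continuous_coeff_mul (continuous_coeff_pow (hlin 0) _)
    (continuous_coeff_pow (hlin 1) _) i

lemma continuous_sym (m : ℕ) : Continuous (sym m) :=
  (continuous_symMatrix m).comp continuous_subtype_val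

/-- The element of `SU(2)` with first row `(u, v)`. -/
noncomputable def ofRow (u v : ℂ) (h : u * star u + v * star v = 1) : SU2 :=
  ⟨!![u, v; -star v, star u], by
    rw [Matrix.mem_specialUnitaryGroup_iff, Matrix.mem_unitaryGroup_iff, Matrix.det_fin_two_of]
    refine ⟨?_, by linear_combination h⟩
    ext i j
    fin_cases i <;> fin_cases j <;>
      simp only [Matrix.mul_apply, Matrix.star_apply, Fin.sum_univ_two, Matrix.one_apply,
        Matrix.of_apply, Matrix.cons_val', Matrix.cons_val_zero, Matrix.cons_val_one,
        Fin.zero_eta, Fin.mk_one, star_neg, star_star, if_true, reduceIte, zero_ne_one,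
        one_ne_zero] <;>
      first | linear_combination h | ring⟩

lemma sym_ofRow_zero_apply (m : ℕ) (u v : ℂ) (h : u * star u + v * star v = 1)
    (j : Fin (m + 1)) : sym m (ofRow u v h) 0 j = u ^ (m - (j : ℕ)) * v ^ (j : ℕ) := by
  change (symPoly m !![u, v; -star v, star u] j).coeff 0 = _
  simp [symPoly, Polynomial.coeff_zero_eq_eval_zero]

lemma sym_ofRow_diagonal_apply (m : ℕ) (u : ℂ) (h : u * star u + 0 * star 0 = 1)
    (i j : Fin (m + 1)) : sym m (ofRow u 0 h) i j =
      if i = j then u ^ (m - (j : ℕ)) * star u ^ (j : ℕ) else 0 := by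
  change (symPoly m !![u, 0; -star 0, star u] j).coeff i = _
  have hpoly : symPoly m !![u, 0; -star 0, star u] j =
      Polynomial.C (u ^ (m - (j : ℕ)) * star u ^ (j : ℕ)) * X ^ (j : ℕ) := by
    simp [symPoly, mul_pow, mul_assoc]
  rw [hpoly, Polynomial.coeff_C_mul_X_pow]
  simp only [Fin.ext_iff]

/-- The scalar of modulus `1` chosen here makes the torus element act on the `i`-th basis vector, of
weight `m - 2 i`, by `-1`. -/
lemma eq_zero_of_sym_mulVec_eq_self {m : ℕ} {v : Fin (m + 1) → ℂ} (hv : ∀ g, sym m g *ᵥ v = v)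
    {i : Fin (m + 1)} (hi : m ≠ 2 * (i : ℕ)) : v i = 0 := by
  have hweight : (m : ℂ) - 2 * (i : ℕ) ≠ 0 := sub_ne_zero.mpr (by exact_mod_cast hi)
  let θ : ℝ := Real.pi / (m - 2 * (i : ℕ))
  let ζ := Complex.exp (θ * Complex.I)
  have hstar : star ζ = Complex.exp (-(θ * Complex.I)) := by
    rw [Complex.star_def, ← Complex.exp_conj, map_mul, Complex.conj_ofReal, Complex.conj_I, mul_neg]
  have hone : ζ * star ζ + 0 * star 0 = 1 := by
    rw [hstar, ← Complex.exp_add, add_neg_cancel, Complex.exp_zero, zero_mul, add_zero]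
  have hneg : ζ ^ (m - (i : ℕ)) * star ζ ^ (i : ℕ) = -1 := by
    rw [hstar, ← Complex.exp_nat_mul, ← Complex.exp_nat_mul, ← Complex.exp_add,
      ← Complex.exp_pi_mul_I, Nat.cast_sub (Nat.lt_succ_iff.mp i.2)]
    have hθ : (θ : ℂ) * ((m : ℂ) - 2 * (i : ℕ)) = Real.pi := by
      simp only [θ]
      push_cast
      exact div_mul_cancel₀ _ hweight
    congr 1
    linear_combination Complex.I * hθ
  have h := congrFun (hv (ofRow ζ 0 hone)) i
  simp only [Matrix.mulVec, dotProduct, sym_ofRow_diagonal_apply, ite_mul, zero_mul,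
    Finset.sum_ite_eq, Finset.mem_univ, if_true, hneg, neg_one_mul] at h
  exact self_eq_neg.mp h.symm

lemma eq_zero_of_forall_sym_mulVec_eq_self {m : ℕ} (hm : m ≠ 0) {v : Fin (m + 1) → ℂ}
    (hv : ∀ g, sym m g *ᵥ v = v) : v = 0 := by
  ext k
  by_contra hk
  have hmk : m = 2 * (k : ℕ) := by
    by_contra hmk
    exact hk (eq_zero_of_sym_mulVec_eq_self hv hmk)
  have hne (j : Fin (m + 1)) (hj : j ≠ k) : v j = 0 :=
    eq_zero_of_sym_mulVec_eq_self hv fun h ↦ hj (Fin.ext (by omega))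
  have hk₀ : 0 ≠ k := fun h ↦ hm (by simpa [← h] using hmk)
  have hrow := congrFun (hv (ofRow (3 / 5) (4 / 5) (by norm_num))) 0
  rw [Matrix.mulVec, dotProduct, Finset.sum_eq_single k (fun j _ hj ↦ by rw [hne j hj, mul_zero])
    (by simp), sym_ofRow_zero_apply,
    hne 0 hk₀] at hrow
  exact mul_ne_zero (mul_ne_zero (by norm_num) (by norm_num)) hk hrow

lemma integral_character_eq_zero {n : ℕ} {ρ : SU2 →* Matrix (Fin n) (Fin n) ℂ}
    (hρ : Continuous ρ) (hinv : ∀ v, (∀ g, ρ g *ᵥ v = v) → v = 0) :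
    ∫ g, character ρ g ∂haarSU2 = 0 := by
  have hint (i j : Fin n) : Integrable (fun g ↦ ρ g i j) haarSU2 :=
    integrable_of_continuous (hρ.matrix_elem i j)
  have hcol (j : Fin n) : (fun i ↦ ∫ g, ρ g i j ∂haarSU2) = 0 := by
    refine hinv _ fun h ↦ funext fun i ↦ ?_
    rw [← integral_mul_left_eq_self (fun g ↦ ρ g i j) h]
    simp only [map_mul, Matrix.mul_apply, Matrix.mulVec, dotProduct]
    rw [integral_finsetSum _ fun k _ ↦ (hint k j).const_mul _]
    simp only [integral_const_mul]
  simp only [character, Matrix.trace, Matrix.diag_apply]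
  rw [integral_finsetSum _ fun i _ ↦ hint i i]
  exact Finset.sum_eq_zero fun i _ ↦ congrFun (hcol i) i

lemma integral_eval_chebyshevS_tr {m : ℕ} (hm : m ≠ 0) :
    ∫ g, (Chebyshev.S ℝ m).eval (tr g) ∂haarSU2 = 0 := by
  have h := integral_character_eq_zero (continuous_sym m) fun v ↦
    eq_zero_of_forall_sym_mulVec_eq_self hm
  simp only [character_sym] at h
  rw [integral_complex_ofReal] at h
  exact Complex.ofReal_eq_zero.mp h

/-! ### Measures of neighbourhoods in `SU(2)` -/

lemma exists_one_div_card_le_measureReal {Ω ι : Type*} [MeasurableSpace Ω] (μ : Measure Ω)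
    [IsProbabilityMeasure μ] {f : Ω → ι} {s : Finset ι} (hf : ∀ ω, f ω ∈ s) :
    ∃ ω₀, 1 / (s.card : ℝ) ≤ μ.real {ω | f ω = f ω₀} := by
  obtain ⟨ω₁⟩ := nonempty_of_isProbabilityMeasure μ
  have hs : 0 < (s.card : ℝ) := by exact_mod_cast Finset.card_pos.mpr ⟨_, hf ω₁⟩
  have hcover : (Set.univ : Set Ω) ⊆ ⋃ i ∈ s, {ω | f ω = i} := fun ω _ ↦
    Set.mem_biUnion (hf ω) rfl
  have hsum : ∑ _i ∈ s, 1 / (s.card : ℝ) ≤ ∑ i ∈ s, μ.real {ω | f ω = i} := by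
    rw [Finset.sum_const, nsmul_eq_mul, mul_one_div_cancel hs.ne', ← probReal_univ (μ := μ)]
    exact (measureReal_mono hcover (measure_ne_top μ _)).trans (measureReal_biUnion_finset_le _ _)
  obtain ⟨i, -, hi⟩ := Finset.exists_le_of_sum_le ⟨_, hf ω₁⟩ hsum
  obtain ⟨ω₀, rfl⟩ : {ω | f ω = i}.Nonempty :=
    nonempty_of_measureReal_ne_zero ((one_div_pos.mpr hs).trans_le hi).ne'
  exact ⟨ω₀, hi⟩

lemma floor_natCast_mul_mem_Icc {x : ℝ} (hx : |x| ≤ 1) (N : ℕ) :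
    ⌊N * x⌋ ∈ Finset.Icc (-N : ℤ) N := by
  obtain ⟨hge, hle⟩ := abs_le.mp hx
  rw [Finset.mem_Icc, Int.le_floor, ← Int.cast_le (R := ℝ)]
  push_cast
  exact ⟨by nlinarith [N.cast_nonneg (α := ℝ)],
    (Int.floor_le _).trans (by nlinarith [N.cast_nonneg (α := ℝ)])⟩

lemma abs_sub_le_of_floor_natCast_mul_eq {N : ℕ} (hN : 0 < N) {x y : ℝ}
    (h : ⌊N * x⌋ = ⌊N * y⌋) : |x - y| ≤ 1 / N := by
  have hN' : (0 : ℝ) < N := by exact_mod_cast hN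
  have hlt := Int.abs_sub_lt_one_of_floor_eq_floor h
  rw [← mul_sub, abs_mul, abs_of_pos hN'] at hlt
  rw [le_div_iff₀' hN']
  exact hlt.le

lemma exists_le_measureReal_forall_abs_sub_le {Ω ι : Type*} [MeasurableSpace Ω] (μ : Measure Ω)
    [IsProbabilityMeasure μ] [Fintype ι] {x : Ω → ι → ℝ} (hx : ∀ ω i, |x ω i| ≤ 1) {N : ℕ}
    (hN : 0 < N) : ∃ ω₀, 1 / (2 * N + 1 : ℝ) ^ Fintype.card ι ≤
      μ.real {ω | ∀ i, |x ω i - x ω₀ i| ≤ 1 / N} := by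
  classical
  obtain ⟨ω₀, h⟩ := exists_one_div_card_le_measureReal μ (f := fun ω i ↦ ⌊N * x ω i⌋)
    (s := Fintype.piFinset fun _ ↦ Finset.Icc (-N : ℤ) N)
    (fun ω ↦ Fintype.mem_piFinset.mpr fun i ↦ floor_natCast_mul_mem_Icc (hx ω i) N)
  have hcard : (Finset.Icc (-N : ℤ) N).card = 2 * N + 1 := by rw [Int.card_Icc]; omega
  simp only [Fintype.card_piFinset, Finset.prod_const, Finset.card_univ, hcard] at h
  push_cast at h
  exact ⟨ω₀, h.trans (measureReal_mono fun ω hω i ↦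
    abs_sub_le_of_floor_natCast_mul_eq hN (congrFun hω i))⟩

/-- The real coordinates of the first column of an element of `SU(2)`. The first column determines
the element. -/
noncomputable def realCoords (g : SU2) : Fin 4 → ℝ :=
  ![((g : Matrix (Fin 2) (Fin 2) ℂ) 0 0).re, ((g : Matrix (Fin 2) (Fin 2) ℂ) 0 0).im,
    ((g : Matrix (Fin 2) (Fin 2) ℂ) 1 0).re, ((g : Matrix (Fin 2) (Fin 2) ℂ) 1 0).im]

lemma abs_realCoords_le_one (g : SU2) (i : Fin 4) : |realCoords g i| ≤ 1 := by
  have hre (k : Fin 2) := (Complex.abs_re_le_norm _).trans (norm_coe_le_one g k 0)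
  have him (k : Fin 2) := (Complex.abs_im_le_norm _).trans (norm_coe_le_one g k 0)
  fin_cases i
  exacts [hre 0, him 0, hre 1, him 1]

lemma abs_tr_mul_sub_tr_mul_le (k g h : SU2) :
    |tr (k * g) - tr (k * h)| ≤ 2 * ∑ i, |realCoords g i - realCoords h i| := by
  have hk (j : Fin 2) (z : ℂ) :
      |((k : Matrix (Fin 2) (Fin 2) ℂ) 0 j * z).re| ≤ |z.re| + |z.im| :=
    calc _ ≤ ‖(k : Matrix (Fin 2) (Fin 2) ℂ) 0 j * z‖ := Complex.abs_re_le_norm _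
      _ ≤ ‖z‖ := by
        rw [norm_mul]
        exact mul_le_of_le_one_left (norm_nonneg z) (norm_coe_le_one k 0 j)
      _ ≤ _ := Complex.norm_le_abs_re_add_abs_im z
  have hdiff : tr (k * g) - tr (k * h) = 2 * (
      ((k : Matrix (Fin 2) (Fin 2) ℂ) 0 0 * ((g : Matrix (Fin 2) (Fin 2) ℂ) 0 0 -
        (h : Matrix (Fin 2) (Fin 2) ℂ) 0 0)).re +
      ((k : Matrix (Fin 2) (Fin 2) ℂ) 0 1 * ((g : Matrix (Fin 2) (Fin 2) ℂ) 1 0 -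
        (h : Matrix (Fin 2) (Fin 2) ℂ) 1 0)).re) := by
    simp only [tr, Submonoid.coe_mul, Matrix.mul_apply, Fin.sum_univ_two, mul_sub, Complex.add_re,
      Complex.sub_re]
    ring
  rw [hdiff, abs_mul, abs_two, Fin.sum_univ_four, add_assoc (_ + _)]
  exact mul_le_mul_of_nonneg_left ((abs_add_le _ _).trans (add_le_add (hk 0 _) (hk 1 _)))
    zero_le_two

/-- Some grid cell has measure at least the average one; by left invariance it can be moved to
`g₀`. -/
lemma le_measureReal_abs_tr_sub_le (g₀ : SU2) {δ : ℝ} (h₀ : 0 < δ) (h₁ : δ ≤ 1) :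
    (δ / 27) ^ 4 ≤ haarSU2.real {g | |tr g - tr g₀| ≤ δ} := by
  have hN₀ : 0 < ⌈8 / δ⌉₊ := Nat.ceil_pos.mpr (by positivity)
  obtain ⟨h, hcell⟩ := exists_le_measureReal_forall_abs_sub_le haarSU2 abs_realCoords_le_one hN₀
  have hN : 8 / δ ≤ ⌈8 / δ⌉₊ := Nat.le_ceil _
  have hN' : (⌈8 / δ⌉₊ : ℝ) < 8 / δ + 1 := Nat.ceil_lt_add_one (by positivity)
  rw [div_le_iff₀ h₀] at hN
  rw [← sub_lt_iff_lt_add, lt_div_iff₀ h₀] at hN'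
  generalize ⌈8 / δ⌉₊ = N at *
  have hNpos : (0 : ℝ) < N := by exact_mod_cast hN₀
  calc (δ / 27) ^ 4 ≤ 1 / (2 * N + 1 : ℝ) ^ 4 := by
        rw [← one_div_pow]
        refine pow_le_pow_left₀ (by positivity) ?_ 4
        rw [div_le_div_iff₀ (by norm_num) (by positivity)]
        nlinarith
    _ ≤ _ := hcell
    _ ≤ haarSU2.real ((fun g ↦ g₀ * h⁻¹ * g) ⁻¹' {g | |tr g - tr g₀| ≤ δ}) := by
        refine measureReal_mono fun g hg ↦ ?_
        have hdist := abs_tr_mul_sub_tr_mul_le (g₀ * h⁻¹) g h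
        have hsum := Finset.sum_le_sum fun i (_ : i ∈ Finset.univ) ↦ hg i
        rw [inv_mul_cancel_right] at hdist
        refine hdist.trans ((mul_le_mul_of_nonneg_left hsum zero_le_two).trans ?_)
        rw [Finset.sum_const, Finset.card_univ, Fintype.card_fin, nsmul_eq_mul, ← mul_assoc,
          mul_one_div, div_le_iff₀ hNpos]
        norm_num only
        linarith
    _ = _ := by rw [measureReal_def, measure_preimage_mul, measureReal_def]

/-! ### Products of exponential integrals over the primes -/

lemma two_le_coe (p : Nat.Primes) : (2 : ℝ) ≤ p := by exact_mod_cast p.2.two_le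

lemma coe_pos (p : Nat.Primes) : (0 : ℝ) < p := two_pos.trans_le (two_le_coe p)

lemma one_div_sq_eq_rpow {x : ℝ} (hx : 0 ≤ x) : 1 / x ^ 2 = x ^ (-2 : ℝ) := by
  rw [Real.rpow_neg hx, one_div, Real.rpow_ofNat]

lemma one_div_sq_le_rpow {x : ℝ} (hx : 1 ≤ x) : 1 / x ^ 2 ≤ x ^ (-(3 / 2) : ℝ) := by
  rw [one_div_sq_eq_rpow (by linarith)]
  exact Real.rpow_le_rpow_of_exponent_le hx (by norm_num)

lemma summable_primes_one_div_sq : Summable fun p : Nat.Primes ↦ 1 / (p : ℝ) ^ 2 := by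
  simp only [one_div_sq_eq_rpow (Nat.cast_nonneg _)]
  exact Nat.Primes.summable_rpow.mpr (by norm_num)

lemma tendsto_coe_primes_cofinite : Tendsto (fun p : Nat.Primes ↦ (p : ℝ)) cofinite atTop :=
  tendsto_natCast_atTop_atTop.comp
    (Nat.cofinite_eq_atTop ▸ Nat.Primes.coe_nat_injective.tendsto_cofinite)

lemma abs_exp_sub_one_sub_le {x B : ℝ} (hx : |x| ≤ B) :
    |Real.exp x - 1 - x| ≤ x ^ 2 * Real.exp B := by
  have h := Complex.norm_exp_sub_sum_le_norm_mul_exp (x : ℂ) 2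
  have hsum : Complex.exp x - ∑ k ∈ Finset.range 2, (x : ℂ) ^ k / k.factorial =
      (Real.exp x - 1 - x : ℝ) := by
    simp only [Finset.sum_range_succ, Finset.sum_range_zero, Nat.factorial]
    push_cast
    ring
  rw [hsum, Complex.norm_real, Complex.norm_real, Real.norm_eq_abs, Real.norm_eq_abs, sq_abs] at h
  exact h.trans (mul_le_mul_of_nonneg_left (Real.exp_le_exp.mpr hx) (sq_nonneg x))

lemma abs_sub_le_of_isGreatest_range {Ω : Type*} {f g : Ω → ℝ} {a b C : ℝ}
    (ha : IsGreatest (Set.range f) a) (hb : IsGreatest (Set.range g) b)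
    (h : ∀ ω, |f ω - g ω| ≤ C) : |a - b| ≤ C := by
  obtain ⟨⟨ω₁, rfl⟩, ha⟩ := ha
  obtain ⟨⟨ω₂, rfl⟩, hb⟩ := hb
  have h₁ := abs_le.mp (h ω₁)
  have h₂ := abs_le.mp (h ω₂)
  have h₃ := ha ⟨ω₂, rfl⟩
  have h₄ := hb ⟨ω₁, rfl⟩
  rw [abs_le]
  constructor <;> linarith

lemma hasSum_ite_one_div_primeRecipSum {r : ℝ} (hr : 0 ≤ r) :
    HasSum (fun p : Nat.Primes ↦ if (p : ℝ) ≤ r then 1 / (p : ℝ) else 0) (primeRecipSum r) := by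
  set s := (Finset.Icc 1 ⌊r⌋₊).filter Nat.Prime
  have hmem (p : Nat.Primes) : (p : ℕ) ∈ s ↔ (p : ℝ) ≤ r := by
    rw [Finset.mem_filter, Finset.mem_Icc, Nat.le_floor_iff hr]
    exact ⟨fun h ↦ h.1.2, fun h ↦ ⟨⟨p.2.one_le, h⟩, p.2⟩⟩
  have hsum : HasSum (fun n : ℕ ↦ if n ∈ s then 1 / (n : ℝ) else 0) (primeRecipSum r) := by
    have h := hasSum_sum_of_ne_finset_zero (s := s) (L := .unconditional ℕ)
      (f := fun n : ℕ ↦ if n ∈ s then 1 / (n : ℝ) else 0) fun n hn ↦ if_neg hn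
    rwa [Finset.sum_ite_mem, Finset.inter_self] at h
  have hsupport (n : ℕ) (hn : n ∉ Set.range ((↑) : Nat.Primes → ℕ)) :
      (if n ∈ s then 1 / (n : ℝ) else 0) = 0 :=
    if_neg fun h ↦ hn ⟨⟨n, (Finset.mem_filter.mp h).2⟩, rfl⟩
  have hcomp : (fun p : Nat.Primes ↦ if (p : ℝ) ≤ r then 1 / (p : ℝ) else 0) =
      (fun n : ℕ ↦ if n ∈ s then 1 / (n : ℝ) else 0) ∘ (↑) :=
    _root_.funext fun p ↦ if_congr (hmem p).symm rfl rfl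
  rw [hcomp]
  exact (Nat.Primes.coe_nat_injective.hasSum_iff hsupport).mpr hsum

section LocalIntegral

variable {Ω : Type*} [MeasurableSpace Ω] {μ : Measure Ω}

/-- A family `l p` of bounded functions on a probability space whose leading part is `χ / p`, with
`χ` centred. The last field is a lower bound for the volume of the set on which `l p` is close to
a given value, in terms of the natural scale `1 / p` of `l p`. -/
structure ExponentFamily (μ : Measure Ω) (χ : Ω → ℝ) (l : Nat.Primes → Ω → ℝ) (K a : ℝ) (d : ℕ) :
    Prop where
  nonneg : 0 ≤ K
  measurable_char : Measurable χ
  measurable : ∀ p, Measurable (l p)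
  abs_char_le : ∀ ω, |χ ω| ≤ K
  integral_char : ∫ ω, χ ω ∂μ = 0
  abs_sub_le : ∀ p ω, |l p ω - χ ω / p| ≤ K / (p : ℝ) ^ 2
  volume_pos : 0 < a
  le_volume : ∀ p ω₀ δ, 0 < δ → δ ≤ 1 → a * δ ^ d ≤ μ.real {ω | |l p ω - l p ω₀| ≤ K / p * δ}

/-- A family `w p` of positive weights on a probability space tending to `1`, whose integrals are
`1` up to the terms of a convergent series. -/
structure WeightFamily (μ : Measure Ω) (w : Nat.Primes → Ω → ℝ) (c L : ℝ) : Prop where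
  pos : 0 < c
  measurable : ∀ p, Measurable (w p)
  le : ∀ p ω, c ≤ w p ω
  le_const : ∀ p ω, w p ω ≤ L
  abs_sub_one_le : ∀ p ω, |w p ω - 1| ≤ L * (p : ℝ) ^ (-(1 / 2) : ℝ)
  abs_integral_sub_one_le : ∀ p, |∫ ω, w p ω ∂μ - 1| ≤ L * (p : ℝ) ^ (-(3 / 2) : ℝ)

/-- The weighted exponential moment `∫ w p * exp (z * l p)`; the local factors of the Euler products
are of this form. -/
noncomputable def localInt (μ : Measure Ω) (w l : Nat.Primes → Ω → ℝ) (z : ℝ) (p : Nat.Primes) :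
    ℝ :=
  ∫ ω, w p ω * Real.exp (z * l p ω) ∂μ

variable {χ : Ω → ℝ} {l w : Nat.Primes → Ω → ℝ} {K a c L : ℝ} {d : ℕ}

namespace ExponentFamily

lemma abs_le (hl : ExponentFamily μ χ l K a d) (p : Nat.Primes) (ω : Ω) :
    |l p ω| ≤ 2 * K / p := by
  have hp := two_le_coe p
  have hχ : |χ ω / p| ≤ K / p := by
    rw [abs_div, abs_of_pos (coe_pos p)]
    exact div_le_div_of_nonneg_right (hl.abs_char_le ω) (coe_pos p).le
  have hsq : K / (p : ℝ) ^ 2 ≤ K / p :=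
    div_le_div_of_nonneg_left hl.nonneg (coe_pos p) (by nlinarith)
  calc |l p ω| = |(l p ω - χ ω / p) + χ ω / p| := by rw [sub_add_cancel]
    _ ≤ K / p + K / p :=
      (abs_add_le _ _).trans (add_le_add ((hl.abs_sub_le p ω).trans hsq) hχ)
    _ = 2 * K / p := by ring

lemma abs_mul_le (hl : ExponentFamily μ χ l K a d) (z : ℝ) (p : Nat.Primes) (ω : Ω) :
    |z * l p ω| ≤ |z| * (2 * K / p) := by
  rw [abs_mul]
  exact mul_le_mul_of_nonneg_left (hl.abs_le p ω) (abs_nonneg z)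

lemma abs_mul_le_of_abs_le (hl : ExponentFamily μ χ l K a d) {z : ℝ} {p : Nat.Primes}
    (hz : |z| ≤ p) (ω : Ω) : |z * l p ω| ≤ 2 * K := by
  have hK := hl.nonneg
  calc |z * l p ω| ≤ |z| * (2 * K / p) := hl.abs_mul_le z p ω
    _ ≤ p * (2 * K / p) := mul_le_mul_of_nonneg_right hz (by positivity)
    _ = 2 * K := mul_div_cancel₀ _ (coe_pos p).ne'

lemma abs_sub_div_le (hl : ExponentFamily μ χ l K a d) {s M : ℝ} {p : Nat.Primes}
    (hs : IsGreatest (Set.range χ) s) (hM : IsGreatest (Set.range (l p)) M) :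
    |M - s / p| ≤ K / (p : ℝ) ^ 2 := by
  refine abs_sub_le_of_isGreatest_range hM ⟨?_, ?_⟩ (hl.abs_sub_le p)
  · obtain ⟨ω, rfl⟩ := hs.1
    exact ⟨ω, rfl⟩
  · rintro _ ⟨ω, rfl⟩
    exact div_le_div_of_nonneg_right (hs.2 ⟨ω, rfl⟩) (coe_pos p).le

lemma summable_sub_div (hl : ExponentFamily μ χ l K a d) {s : ℝ} {M : Nat.Primes → ℝ}
    (hs : IsGreatest (Set.range χ) s) (hM : ∀ p, IsGreatest (Set.range (l p)) (M p)) :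
    Summable fun p : Nat.Primes ↦ M p - s / p := by
  refine (summable_primes_one_div_sq.mul_left K).of_norm_bounded fun p ↦ ?_
  rw [mul_one_div]
  exact hl.abs_sub_div_le hs (hM p)

end ExponentFamily

namespace WeightFamily

lemma const_nonneg [NeZero μ] (hw : WeightFamily μ w c L) : 0 ≤ L := by
  obtain ⟨ω⟩ := μ.nonempty_of_neZero
  exact hw.pos.le.trans ((hw.le ⟨2, Nat.prime_two⟩ ω).trans (hw.le_const _ ω))

lemma abs_le (hw : WeightFamily μ w c L) (p : Nat.Primes) (ω : Ω) : |w p ω| ≤ L := by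
  rw [abs_of_pos (hw.pos.trans_le (hw.le p ω))]
  exact hw.le_const p ω

end WeightFamily

variable [IsProbabilityMeasure μ]

lemma integrable_integrand (hl : ExponentFamily μ χ l K a d) (hw : WeightFamily μ w c L) (z : ℝ)
    (p : Nat.Primes) : Integrable (fun ω ↦ w p ω * Real.exp (z * l p ω)) μ := by
  refine .of_bound ((hw.measurable p).mul ((hl.measurable p).const_mul z).exp).aestronglyMeasurable
    (L * Real.exp (|z| * (2 * K / p))) (.of_forall fun ω ↦ ?_)
  rw [Real.norm_eq_abs, abs_mul, Real.abs_exp]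
  exact mul_le_mul (hw.abs_le p ω)
    (Real.exp_le_exp.mpr ((le_abs_self _).trans (hl.abs_mul_le z p ω))) (Real.exp_pos _).le
    hw.const_nonneg

lemma mul_exp_neg_le_localInt (hl : ExponentFamily μ χ l K a d) (hw : WeightFamily μ w c L)
    {z B : ℝ} {p : Nat.Primes} (hB : ∀ ω, |z * l p ω| ≤ B) :
    c * Real.exp (-B) ≤ localInt μ w l z p := by
  have h := integral_mono (integrable_const (μ := μ) (c * Real.exp (-B)))
    (integrable_integrand hl hw z p) fun ω ↦ mul_le_mul (hw.le p ω)
      (Real.exp_le_exp.mpr (abs_le.mp (hB ω)).1) (Real.exp_pos _).le (hw.pos.le.trans (hw.le p ω))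
  rwa [integral_const, probReal_univ, one_smul] at h

lemma localInt_pos (hl : ExponentFamily μ χ l K a d) (hw : WeightFamily μ w c L) (z : ℝ)
    (p : Nat.Primes) : 0 < localInt μ w l z p :=
  (mul_pos hw.pos (Real.exp_pos _)).trans_le (mul_exp_neg_le_localInt hl hw (hl.abs_mul_le z p))

lemma abs_integrand_sub_le (hl : ExponentFamily μ χ l K a d) (hw : WeightFamily μ w c L) {z : ℝ}
    {p : Nat.Primes} (hz : |z| ≤ p) (ω : Ω) :
    |w p ω * Real.exp (z * l p ω) - w p ω - z / p * χ ω| ≤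
      4 * L * K ^ 2 * Real.exp (2 * K) * (z ^ 2 * (1 / (p : ℝ) ^ 2)) +
        2 * L * K * (|z| * (p : ℝ) ^ (-(3 / 2) : ℝ)) := by
  have hL := hw.const_nonneg
  have hK := hl.nonneg
  have hp := coe_pos p
  have hquadratic : |w p ω * (Real.exp (z * l p ω) - 1 - z * l p ω)| ≤
      4 * L * K ^ 2 * Real.exp (2 * K) * (z ^ 2 * (1 / (p : ℝ) ^ 2)) := by
    have hsq : (z * l p ω) ^ 2 ≤ (|z| * (2 * K / p)) ^ 2 := by
      rw [← sq_abs]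
      exact pow_le_pow_left₀ (abs_nonneg _) (hl.abs_mul_le z p ω) 2
    rw [abs_mul]
    calc _ ≤ L * ((|z| * (2 * K / p)) ^ 2 * Real.exp (2 * K)) :=
          mul_le_mul (hw.abs_le p ω) ((abs_exp_sub_one_sub_le (hl.abs_mul_le_of_abs_le hz ω)).trans
            (mul_le_mul_of_nonneg_right hsq (Real.exp_pos _).le)) (abs_nonneg _) hL
      _ = _ := by rw [mul_pow, sq_abs]; ring
  have hlinear : |w p ω * (z * (l p ω - χ ω / p))| ≤ L * K * (|z| * (p : ℝ) ^ (-(3 / 2) : ℝ)) := by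
    rw [abs_mul, abs_mul]
    calc _ ≤ L * (|z| * (K * (1 / (p : ℝ) ^ 2))) := by
          rw [mul_one_div]
          gcongr
          exacts [hw.abs_le p ω, hl.abs_sub_le p ω]
      _ ≤ L * (|z| * (K * (p : ℝ) ^ (-(3 / 2) : ℝ))) := by
          gcongr
          exact one_div_sq_le_rpow (by linarith [two_le_coe p])
      _ = _ := by ring
  have hweight : |(w p ω - 1) * (z / p * χ ω)| ≤ L * K * (|z| * (p : ℝ) ^ (-(3 / 2) : ℝ)) := by
    rw [abs_mul, abs_mul, abs_div, abs_of_pos hp]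
    calc _ ≤ L * (p : ℝ) ^ (-(1 / 2) : ℝ) * (|z| / p * K) := by
          gcongr
          exacts [hw.abs_sub_one_le p ω, hl.abs_char_le ω]
      _ = L * K * (|z| * ((p : ℝ) ^ (-(1 / 2) : ℝ) / p)) := by ring
      _ = _ := by rw [← Real.rpow_sub_one hp.ne']; norm_num
  have hdecomp : w p ω * Real.exp (z * l p ω) - w p ω - z / p * χ ω =
      w p ω * (Real.exp (z * l p ω) - 1 - z * l p ω) + w p ω * (z * (l p ω - χ ω / p)) +
        (w p ω - 1) * (z / p * χ ω) := by ring
  rw [hdecomp]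
  exact (abs_add_three _ _ _).trans (by linarith)

lemma exists_abs_localInt_sub_one_le (hl : ExponentFamily μ χ l K a d)
    (hw : WeightFamily μ w c L) : ∃ A, 0 ≤ A ∧ ∀ (z : ℝ) (p : Nat.Primes), |z| ≤ p →
      |localInt μ w l z p - 1| ≤
        A * (z ^ 2 * (1 / (p : ℝ) ^ 2) + (1 + |z|) * (p : ℝ) ^ (-(3 / 2) : ℝ)) := by
  have hL := hw.const_nonneg
  have hK := hl.nonneg
  set E := 4 * L * K ^ 2 * Real.exp (2 * K)
  have hE : 0 ≤ E := by positivity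
  refine ⟨E + 2 * L * K + L, by positivity, fun z p hz ↦ ?_⟩
  have hwint : Integrable (w p) μ :=
    .of_bound (hw.measurable p).aestronglyMeasurable L (.of_forall (hw.abs_le p))
  have hχint : Integrable χ μ :=
    .of_bound hl.measurable_char.aestronglyMeasurable K (.of_forall hl.abs_char_le)
  have hint : ∫ ω, (w p ω * Real.exp (z * l p ω) - w p ω - z / p * χ ω) ∂μ =
      localInt μ w l z p - ∫ ω, w p ω ∂μ := by
    rw [integral_sub (f := fun ω ↦ w p ω * Real.exp (z * l p ω) - w p ω)
        ((integrable_integrand hl hw z p).sub hwint) (hχint.const_mul _),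
      integral_sub (integrable_integrand hl hw z p) hwint, integral_const_mul, hl.integral_char,
      mul_zero, sub_zero, localInt]
  have hmain := norm_integral_le_of_norm_le_const (μ := μ)
    (f := fun ω ↦ w p ω * Real.exp (z * l p ω) - w p ω - z / p * χ ω)
    (.of_forall (abs_integrand_sub_le hl hw hz))
  rw [hint, probReal_univ, mul_one, Real.norm_eq_abs] at hmain
  set x := z ^ 2 * (1 / (p : ℝ) ^ 2)
  set y := (p : ℝ) ^ (-(3 / 2) : ℝ)
  have hx : 0 ≤ (2 * L * K + L) * x := by positivity
  have hy : 0 ≤ (E + 2 * L * K) * y + (E + L) * (|z| * y) := by positivity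
  calc |localInt μ w l z p - 1|
      ≤ |localInt μ w l z p - ∫ ω, w p ω ∂μ| + |∫ ω, w p ω ∂μ - 1| := abs_sub_le _ _ _
    _ ≤ E * x + 2 * L * K * (|z| * y) + L * y := add_le_add hmain (hw.abs_integral_sub_one_le p)
    _ ≤ (E + 2 * L * K + L) * (x + (1 + |z|) * y) := by linarith

lemma exists_abs_log_localInt_le (hl : ExponentFamily μ χ l K a d) (hw : WeightFamily μ w c L) :
    ∃ A, 0 ≤ A ∧ ∀ (z : ℝ) (p : Nat.Primes), |z| ≤ p → |Real.log (localInt μ w l z p)| ≤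
      A * (z ^ 2 * (1 / (p : ℝ) ^ 2) + (1 + |z|) * (p : ℝ) ^ (-(3 / 2) : ℝ)) := by
  obtain ⟨A, hA, h⟩ := exists_abs_localInt_sub_one_le hl hw
  have hpos : 0 < min (c * Real.exp (-(2 * K))) 1 :=
    lt_min (mul_pos hw.pos (Real.exp_pos _)) one_pos
  refine ⟨A / min (c * Real.exp (-(2 * K))) 1, by positivity, fun z p hz ↦ ?_⟩
  have hlow := mul_exp_neg_le_localInt hl hw (hl.abs_mul_le_of_abs_le hz)
  have hlog := abs_log_sub_log_le hpos ((min_le_left _ _).trans hlow) (min_le_right _ 1)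
  rw [Real.log_one, sub_zero] at hlog
  rw [div_mul_eq_mul_div]
  exact hlog.trans (div_le_div_of_nonneg_right (h z p hz) hpos.le)

lemma summable_log_localInt (hl : ExponentFamily μ χ l K a d) (hw : WeightFamily μ w c L)
    (z : ℝ) : Summable fun p ↦ Real.log (localInt μ w l z p) := by
  obtain ⟨A, -, h⟩ := exists_abs_log_localInt_le hl hw
  have hrpow : Summable fun p : Nat.Primes ↦ (p : ℝ) ^ (-(3 / 2) : ℝ) :=
    Nat.Primes.summable_rpow.mpr (by norm_num)
  have hbound : Summable fun p : Nat.Primes ↦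
      A * (z ^ 2 * (1 / (p : ℝ) ^ 2) + (1 + |z|) * (p : ℝ) ^ (-(3 / 2) : ℝ)) :=
    ((summable_primes_one_div_sq.mul_left _).add (hrpow.mul_left _)).mul_left A
  refine hbound.of_norm_bounded_eventually ?_
  filter_upwards [tendsto_coe_primes_cofinite.eventually_ge_atTop |z|] with p hp
  exact h z p hp

lemma localInt_le (hl : ExponentFamily μ χ l K a d) (hw : WeightFamily μ w c L) {r M : ℝ}
    {p : Nat.Primes} (hr : 0 ≤ r) (hM : M ∈ upperBounds (Set.range (l p))) :
    localInt μ w l r p ≤ L * Real.exp (r * M) := by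
  have h := integral_mono (integrable_integrand hl hw r p)
    (integrable_const (μ := μ) (L * Real.exp (r * M))) fun ω ↦ mul_le_mul (hw.le_const p ω)
      (Real.exp_le_exp.mpr (mul_le_mul_of_nonneg_left (hM ⟨ω, rfl⟩) hr)) (Real.exp_pos _).le
      hw.const_nonneg
  rwa [integral_const, probReal_univ, one_smul] at h

lemma le_localInt (hl : ExponentFamily μ χ l K a d) (hw : WeightFamily μ w c L) {r : ℝ}
    {p : Nat.Primes} (hr : (p : ℝ) ≤ r) (ω₀ : Ω) :
    c * Real.exp (r * l p ω₀ - K) * (a * (p / r) ^ d) ≤ localInt μ w l r p := by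
  have hp := coe_pos p
  have hr₀ : 0 < r := hp.trans_le hr
  have hc := hw.pos
  have hnonneg : 0 ≤ᵐ[μ] fun ω ↦ w p ω * Real.exp (r * l p ω) :=
    .of_forall fun ω ↦ mul_nonneg (hc.le.trans (hw.le p ω)) (Real.exp_pos _).le
  refine le_trans ?_ (mul_meas_ge_le_integral_of_nonneg hnonneg (integrable_integrand hl hw r p)
    (c * Real.exp (r * l p ω₀ - K)))
  refine mul_le_mul_of_nonneg_left ((hl.le_volume p ω₀ (p / r) (by positivity)
    ((div_le_one hr₀).mpr hr)).trans (measureReal_mono fun ω hω ↦ ?_)) (by positivity)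
  have hclose : r * (l p ω₀ - l p ω) ≤ K := by
    calc r * (l p ω₀ - l p ω) ≤ r * (K / p * (p / r)) := by
          rw [Set.mem_ofPred_eq, abs_sub_comm] at hω
          exact mul_le_mul_of_nonneg_left ((le_abs_self _).trans hω) hr₀.le
      _ = K := by field_simp
  exact mul_le_mul (hw.le p ω) (Real.exp_le_exp.mpr (by linarith)) (Real.exp_pos _).le
    (hc.le.trans (hw.le p ω))

lemma exists_abs_log_localInt_sub_le (hl : ExponentFamily μ χ l K a d)
    (hw : WeightFamily μ w c L) : ∃ B, 0 ≤ B ∧ ∀ (r M : ℝ) (p : Nat.Primes), (p : ℝ) ≤ r →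
      IsGreatest (Set.range (l p)) M →
        |Real.log (localInt μ w l r p) - r * M| ≤ B * (1 + Real.log (r / p)) := by
  have hK := hl.nonneg
  have hc := hw.pos
  have ha := hl.volume_pos
  obtain ⟨ω⟩ := μ.nonempty_of_neZero
  have hL : 0 < L := hc.trans_le ((hw.le ⟨2, Nat.prime_two⟩ ω).trans (hw.le_const _ ω))
  set B := |Real.log L| + |Real.log c| + K + |Real.log a| + d with hB
  refine ⟨B, by positivity, fun r M p hr hM ↦ ?_⟩
  have hp := coe_pos p
  have hr₀ : 0 < r := hp.trans_le hr
  have hupper := Real.log_le_log (localInt_pos hl hw r p) (localInt_le hl hw hr₀.le hM.2)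
  obtain ⟨⟨ω₀, rfl⟩, -⟩ := hM
  have hlower := Real.log_le_log (by positivity) (le_localInt hl hw hr ω₀)
  rw [Real.log_mul hL.ne' (Real.exp_pos _).ne', Real.log_exp] at hupper
  rw [Real.log_mul (by positivity) (by positivity), Real.log_mul hc.ne' (Real.exp_pos _).ne',
    Real.log_exp, Real.log_mul ha.ne' (by positivity), Real.log_pow, ← inv_div r (p : ℝ),
    Real.log_inv] at hlower
  have hlog : 0 ≤ Real.log (r / p) := Real.log_nonneg ((one_le_div hp).mpr hr)
  have hdB : (d : ℝ) ≤ B := by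
    rw [hB]
    linarith [abs_nonneg (Real.log L), abs_nonneg (Real.log c), abs_nonneg (Real.log a)]
  have hmul : d * Real.log (r / p) ≤ B * Real.log (r / p) := mul_le_mul_of_nonneg_right hdB hlog
  have hBlog : 0 ≤ B * Real.log (r / p) := by positivity
  rw [abs_le, mul_one_add]
  constructor <;>
    linarith [le_abs_self (Real.log L), neg_abs_le (Real.log c), neg_abs_le (Real.log a),
      abs_nonneg (Real.log L), abs_nonneg (Real.log c), abs_nonneg (Real.log a),
      d.cast_nonneg (α := ℝ)]

lemma isBigO_tsum_log_localInt_sub (hl : ExponentFamily μ χ l K a d) (hw : WeightFamily μ w c L)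
    {s : ℝ} {M : Nat.Primes → ℝ} (hs : IsGreatest (Set.range χ) s)
    (hM : ∀ p, IsGreatest (Set.range (l p)) (M p)) :
    (fun r ↦ ∑' p : Nat.Primes, (Real.log (localInt μ w l r p) - r * (M p - s / p) -
      r * s * if (p : ℝ) ≤ r then 1 / (p : ℝ) else 0)) =O[atTop] fun r ↦ r / Real.log r := by
  have hK := hl.nonneg
  obtain ⟨A, hA, htail⟩ := exists_abs_log_localInt_le hl hw
  obtain ⟨B, hB, hhead⟩ := exists_abs_log_localInt_sub_le hl hw
  refine isBigO_tsum_primes (A := 2 * A + B + K) (s := -(3 / 2)) (by positivity) (by norm_num)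
    (.of_forall fun r p hpr ↦ ?_) ?_
  · have hlog : 0 ≤ Real.log (r / p) := Real.log_nonneg ((one_le_div (coe_pos p)).mpr hpr)
    have hcancel : Real.log (localInt μ w l r p) - r * (M p - s / p) - r * s * (1 / p) =
        Real.log (localInt μ w l r p) - r * M p := by ring
    rw [if_pos hpr, hcancel]
    exact (hhead r (M p) p hpr (hM p)).trans
      (mul_le_mul_of_nonneg_right (by linarith) (by positivity))
  · filter_upwards [eventually_ge_atTop 1] with r hr p hpr
    have hrabs : |r| = r := abs_of_nonneg (by linarith)
    have hlog := htail r p (by rw [hrabs]; exact hpr.le)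
    have hdefect : |r * (M p - s / p)| ≤ K * (r ^ 2 * (1 / (p : ℝ) ^ 2)) := by
      calc |r * (M p - s / p)| ≤ r * (K / (p : ℝ) ^ 2) := by
            rw [abs_mul, hrabs]
            exact mul_le_mul_of_nonneg_left (hl.abs_sub_div_le hs (hM p)) (by linarith)
        _ ≤ r ^ 2 * (K / (p : ℝ) ^ 2) :=
          mul_le_mul_of_nonneg_right (le_self_pow₀ hr two_ne_zero) (by positivity)
        _ = K * (r ^ 2 * (1 / (p : ℝ) ^ 2)) := by ring
    rw [hrabs] at hlog
    rw [if_neg hpr.not_ge, mul_zero, sub_zero]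
    set x := r ^ 2 * (1 / (p : ℝ) ^ 2)
    set y := (p : ℝ) ^ (-(3 / 2) : ℝ)
    calc _ ≤ A * (x + (1 + r) * y) + K * x := (abs_sub _ _).trans (add_le_add hlog hdefect)
      _ ≤ A * (2 * x + 2 * r * y) + K * x := by gcongr <;> linarith [show 0 ≤ x by positivity]
      _ = (2 * A + K) * x + 2 * A * (r * y) := by ring
      _ ≤ (2 * A + B + K) * x + (2 * A + B + K) * (r * y) := by gcongr <;> linarith
      _ = (2 * A + B + K) * (x + r * y) := by ring

theorem isBigO_tsum_log_localInt (hl : ExponentFamily μ χ l K a d) (hw : WeightFamily μ w c L)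
    {s : ℝ} {M : Nat.Primes → ℝ} (hs : IsGreatest (Set.range χ) s)
    (hM : ∀ p, IsGreatest (Set.range (l p)) (M p)) :
    (fun r ↦ ∑' p, Real.log (localInt μ w l r p) -
      (s * r * Real.log (Real.log r) + (gammaStar * s + ∑' p, (M p - s / p)) * r))
        =O[atTop] fun r ↦ r / Real.log r := by
  obtain ⟨C, hC⟩ := exists_abs_primeRecipSum_sub_gammaStar_le
  have hmertens : (fun r ↦ r * s * (primeRecipSum r - (Real.log (Real.log r) + gammaStar)))
      =O[atTop] fun r ↦ r / Real.log r := by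
    refine .of_bound (|s| * C) ?_
    filter_upwards [eventually_ge_atTop 2] with r hr
    have hlog : 0 < Real.log r := Real.log_pos (by linarith)
    rw [norm_mul, norm_mul, norm_div, Real.norm_of_nonneg hlog.le]
    calc _ ≤ ‖r‖ * ‖s‖ * (C / Real.log r) := mul_le_mul_of_nonneg_left (hC r hr) (by positivity)
      _ = |s| * C * (‖r‖ / Real.log r) := by rw [Real.norm_eq_abs s]; ring
  refine ((isBigO_tsum_log_localInt_sub hl hw hs hM).add hmertens).congr' ?_ .rfl
  filter_upwards [eventually_ge_atTop 0] with r hr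
  have hmain := hasSum_ite_one_div_primeRecipSum hr
  have hdefect := hl.summable_sub_div hs hM
  rw [((summable_log_localInt hl hw r).sub (hdefect.mul_left r)).tsum_sub
      (hmain.summable.mul_left _), (summable_log_localInt hl hw r).tsum_sub (hdefect.mul_left r),
    tsum_mul_left, tsum_mul_left, hmain.tsum_eq]
  ring

end LocalIntegral

/-! ### The Euler products over `SU(2)` -/

/-- `log D(p⁻¹, sym^m, g)`. -/
noncomputable def logD (m : ℕ) (p : Nat.Primes) (g : SU2) : ℝ :=
  -Real.log (symDet m (p : ℝ)⁻¹ (tr g))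

lemma inv_coe_nonneg (p : Nat.Primes) : 0 ≤ (p : ℝ)⁻¹ := (inv_pos.mpr (coe_pos p)).le

lemma inv_coe_le (p : Nat.Primes) : (p : ℝ)⁻¹ ≤ 3 / 4 :=
  (inv_anti₀ two_pos (two_le_coe p)).trans (by norm_num)

lemma symDet_inv_coe_pos (m : ℕ) (p : Nat.Primes) (g : SU2) : 0 < symDet m (p : ℝ)⁻¹ (tr g) :=
  symDet_pos (inv_coe_nonneg p) (inv_coe_le p) (abs_tr_le g) m

lemma exp_logD (m : ℕ) (p : Nat.Primes) (g : SU2) :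
    Real.exp (logD m p g) = (symDet m (p : ℝ)⁻¹ (tr g))⁻¹ := by
  rw [logD, Real.exp_neg, Real.exp_log (symDet_inv_coe_pos m p g)]

lemma continuous_logD (m : ℕ) (p : Nat.Primes) : Continuous (logD m p) :=
  (((continuous_symDet m _).comp continuous_tr).log fun g ↦ (symDet_inv_coe_pos m p g).ne').neg

lemma continuous_eval_chebyshevS_tr (m : ℕ) :
    Continuous fun g ↦ (Chebyshev.S ℝ m).eval (tr g) :=
  (Chebyshev.S ℝ m).continuous.comp continuous_tr

theorem exists_exponentFamily_logD {m : ℕ} (hm : m ≠ 0) {ε : ℝ} (hε : |ε| = 1) :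
    ∃ K, ExponentFamily haarSU2 (fun g ↦ ε * (Chebyshev.S ℝ m).eval (tr g))
      (fun p g ↦ ε * logD m p g) K ((1 / 27) ^ 4) 4 := by
  obtain ⟨K₁, hK₁, hexpansion⟩ := exists_abs_log_symDet_add_le m
  obtain ⟨K₂, hK₂, hlipschitz⟩ := exists_abs_log_symDet_sub_log_symDet_le m
  refine ⟨(m + 1) + K₁ + K₂, ?_⟩
  have hle₁ : K₁ ≤ (m + 1) + K₁ + K₂ := by linarith [m.cast_nonneg (α := ℝ)]
  have hle₂ : K₂ ≤ (m + 1) + K₁ + K₂ := by linarith [m.cast_nonneg (α := ℝ)]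
  constructor
  case nonneg => positivity
  case measurable_char => exact ((continuous_eval_chebyshevS_tr m).const_mul ε).measurable
  case measurable => exact fun p ↦ ((continuous_logD m p).const_mul ε).measurable
  case abs_char_le =>
    intro g
    rw [abs_mul, hε, one_mul]
    linarith [abs_eval_chebyshevS_le (abs_tr_le g) m]
  case integral_char => rw [integral_const_mul, integral_eval_chebyshevS_tr hm, mul_zero]
  case abs_sub_le =>
    intro p g
    rw [mul_div_assoc, ← mul_sub, abs_mul, hε, one_mul, logD, ← neg_add', abs_neg, div_eq_mul_inv,
      div_eq_mul_inv, ← inv_pow]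
    exact (hexpansion _ _ (inv_coe_nonneg p) (inv_coe_le p) (abs_tr_le g)).trans
      (mul_le_mul_of_nonneg_right hle₁ (by positivity))
  case volume_pos => positivity
  case le_volume =>
    intro p g₀ δ h₀ h₁
    rw [← mul_pow, one_div_mul_eq_div]
    refine (le_measureReal_abs_tr_sub_le g₀ h₀ h₁).trans (measureReal_mono fun g hg ↦ ?_)
    rw [Set.mem_ofPred_eq] at hg ⊢
    rw [← mul_sub, abs_mul, hε, one_mul, logD, logD, neg_sub_neg, abs_sub_comm, div_eq_mul_inv]
    refine (hlipschitz _ _ _ (inv_coe_nonneg p) (inv_coe_le p) (abs_tr_le g)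
      (abs_tr_le g₀)).trans ?_
    have := inv_coe_nonneg p
    gcongr

/-- The weights `D(p ^ (-s), sym^n, g)`. -/
noncomputable def eulerWeight (n : ℕ) (s : ℝ) (p : Nat.Primes) (g : SU2) : ℝ :=
  (symDet n ((p : ℝ) ^ (-s)) (tr g))⁻¹

lemma coe_rpow_neg_nonneg (p : Nat.Primes) (s : ℝ) : 0 ≤ (p : ℝ) ^ (-s) :=
  Real.rpow_nonneg (coe_pos p).le _

lemma coe_rpow_neg_le_rpow_neg_half {s : ℝ} (hs : 1 / 2 ≤ s) (p : Nat.Primes) :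
    (p : ℝ) ^ (-s) ≤ (p : ℝ) ^ (-(1 / 2) : ℝ) :=
  Real.rpow_le_rpow_of_exponent_le (by linarith [two_le_coe p]) (by linarith)

lemma coe_rpow_neg_le {s : ℝ} (hs : 1 / 2 ≤ s) (p : Nat.Primes) : (p : ℝ) ^ (-s) ≤ 3 / 4 := by
  refine (coe_rpow_neg_le_rpow_neg_half hs p).trans (abs_le_of_sq_le_sq' ?_ (by norm_num)).2
  rw [← Real.rpow_mul_natCast (coe_pos p).le, Nat.cast_ofNat, neg_mul, one_div_mul_cancel
    two_ne_zero, Real.rpow_neg_one]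
  exact (inv_anti₀ two_pos (two_le_coe p)).trans (by norm_num)

lemma continuous_eulerWeight (n : ℕ) {s : ℝ} (hs : 1 / 2 ≤ s) (p : Nat.Primes) :
    Continuous (eulerWeight n s p) :=
  ((continuous_symDet n _).comp continuous_tr).inv₀ fun g ↦
    (symDet_pos (coe_rpow_neg_nonneg p s) (coe_rpow_neg_le hs p) (abs_tr_le g) n).ne'

lemma exists_weightFamily_eulerWeight {n : ℕ} {s K : ℝ} (hs : 1 / 2 ≤ s)
    (hint : ∀ p, |∫ g, eulerWeight n s p g ∂haarSU2 - 1| ≤ K * (p : ℝ) ^ (-(3 / 2) : ℝ)) :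
    ∃ c L, WeightFamily haarSU2 (eulerWeight n s) c L := by
  obtain ⟨K', hK', hone⟩ := exists_abs_inv_symDet_sub_one_le n
  refine ⟨(2 ^ (n + 1))⁻¹, 4 ^ (n + 1) + K' + |K|, ?_⟩
  have hpow : (0 : ℝ) < 4 ^ (n + 1) := by positivity
  have h₀ p := coe_rpow_neg_nonneg p s
  have h₁ p := coe_rpow_neg_le hs p
  constructor
  case pos => positivity
  case measurable => exact fun p ↦ (continuous_eulerWeight n hs p).measurable
  case le =>
    refine fun p g ↦ inv_anti₀ (symDet_pos (h₀ p) (h₁ p) (abs_tr_le g) n) ?_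
    exact (symDet_le_one_add_pow (h₀ p) (abs_tr_le g) n).trans
      (pow_le_pow_left₀ (by linarith [h₀ p]) (by linarith [h₁ p]) _)
  case le_const =>
    intro p g
    have h := inv_anti₀ (by positivity) (quarter_pow_le_symDet (h₀ p) (h₁ p) (abs_tr_le g) n)
    rw [one_div, inv_pow, inv_inv] at h
    exact h.trans (by linarith [abs_nonneg K])
  case abs_sub_one_le =>
    intro p g
    calc _ ≤ K' * (p : ℝ) ^ (-s) := hone _ _ (h₀ p) (h₁ p) (abs_tr_le g)
      _ ≤ (4 ^ (n + 1) + K' + |K|) * (p : ℝ) ^ (-(1 / 2) : ℝ) :=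
        mul_le_mul (by linarith [abs_nonneg K]) (coe_rpow_neg_le_rpow_neg_half hs p) (h₀ p)
          (by positivity)
  case abs_integral_sub_one_le =>
    exact fun p ↦ (hint p).trans
      (mul_le_mul_of_nonneg_right (by linarith [le_abs_self K]) (by positivity))

lemma abs_integral_sub_le {f₁ f₂ : SU2 → ℝ} (h₁ : Continuous f₁) (h₂ : Continuous f₂) {C : ℝ}
    (h : ∀ g, |f₁ g - f₂ g| ≤ C) : |∫ g, f₁ g ∂haarSU2 - ∫ g, f₂ g ∂haarSU2| ≤ C := by
  rw [← integral_sub (integrable_of_continuous h₁) (integrable_of_continuous h₂)]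
  have hnorm := norm_integral_le_of_norm_le_const (μ := haarSU2) (f := fun g ↦ f₁ g - f₂ g)
    (.of_forall h)
  rwa [probReal_univ, mul_one] at hnorm

theorem exists_weightFamily_sym {n : ℕ} (hn : n ≠ 0) :
    ∃ c L, WeightFamily haarSU2 (eulerWeight n 1) c L := by
  obtain ⟨K, hK, hexpansion⟩ := exists_abs_inv_symDet_sub_le n
  refine exists_weightFamily_eulerWeight (K := K) (by norm_num) fun p ↦ ?_
  have hs : (1 / 2 : ℝ) ≤ 1 := by norm_num
  set X := (p : ℝ) ^ (-1 : ℝ) with hX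
  have hcont : Continuous fun g ↦ 1 + (Chebyshev.S ℝ n).eval (tr g) * X :=
    continuous_const.add ((continuous_eval_chebyshevS_tr n).mul continuous_const)
  have hint : ∫ g, (1 + (Chebyshev.S ℝ n).eval (tr g) * X) ∂haarSU2 = 1 := by
    rw [integral_add (integrable_const _)
      ((integrable_of_continuous (continuous_eval_chebyshevS_tr n)).mul_const X),
      integral_mul_const, integral_eval_chebyshevS_tr hn, integral_const, probReal_univ, one_smul,
      zero_mul, add_zero]
  have h := abs_integral_sub_le (continuous_eulerWeight n hs p) hcont fun g ↦
    hexpansion X (tr g) (coe_rpow_neg_nonneg p 1) (coe_rpow_neg_le hs p) (abs_tr_le g)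
  rw [hint] at h
  refine h.trans (mul_le_mul_of_nonneg_left ?_ hK)
  rw [hX, Real.rpow_neg_one, inv_pow, ← one_div]
  exact one_div_sq_le_rpow (by linarith [two_le_coe p])

theorem exists_weightFamily_st : ∃ c L, WeightFamily haarSU2 (eulerWeight 1 (1 / 2)) c L := by
  -- `X = p ^ (-1 / 2)` is not small enough for the linear term alone, but the terms in `X` and in
  -- `X ^ 2` both integrate to `0`.
  refine exists_weightFamily_eulerWeight (K := 112) le_rfl fun p ↦ ?_
  set X := (p : ℝ) ^ (-(1 / 2) : ℝ)
  have hcont (k : ℕ) : Continuous fun g ↦ (Chebyshev.S ℝ k).eval (tr g) * X ^ k :=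
    (continuous_eval_chebyshevS_tr k).mul continuous_const
  have hint : ∫ g, ∑ k ∈ Finset.range 3, (Chebyshev.S ℝ k).eval (tr g) * X ^ k ∂haarSU2 = 1 := by
    rw [integral_finsetSum _ fun k _ ↦ integrable_of_continuous (hcont k), Finset.sum_range_succ',
      Finset.sum_eq_zero fun k _ ↦ ?_]
    · simp
    · rw [integral_mul_const, integral_eval_chebyshevS_tr k.succ_ne_zero, zero_mul]
  have h := abs_integral_sub_le (continuous_eulerWeight 1 le_rfl p)
    (continuous_finsetSum _ fun k _ ↦ hcont k) fun g ↦
      abs_inv_quad_sub_sum_le (coe_rpow_neg_nonneg p _) (coe_rpow_neg_le le_rfl p) (abs_tr_le g) 2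
  rw [hint] at h
  refine h.trans_eq ?_
  rw [← Real.rpow_mul_natCast (coe_pos p).le]
  norm_num

lemma ofReal_coe_rpow (p : Nat.Primes) (s : ℝ) :
    (((p : ℝ) ^ (-s) : ℝ) : ℂ) = (p : ℂ) ^ (-(s : ℂ)) := by
  rw [Complex.ofReal_cpow (coe_pos p).le, Complex.ofReal_neg, Complex.ofReal_natCast]

lemma eulerD_cpow_sym (n : ℕ) (s : ℝ) (p : Nat.Primes) (g : SU2) :
    eulerD ((p : ℂ) ^ (-(s : ℂ))) (sym n) g = (eulerWeight n s p g : ℂ) := by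
  rw [← ofReal_coe_rpow, eulerD_sym, eulerWeight]

lemma eulerD_cpow_st (s : ℝ) (p : Nat.Primes) (g : SU2) :
    eulerD ((p : ℂ) ^ (-(s : ℂ))) st g = (eulerWeight 1 s p g : ℂ) := by
  rw [← ofReal_coe_rpow, eulerD_st, eulerWeight]

lemma eulerD_inv_sym (m : ℕ) (p : Nat.Primes) (g : SU2) :
    eulerD (p : ℂ)⁻¹ (sym m) g = (Real.exp (logD m p g) : ℂ) := by
  rw [exp_logD, ← eulerD_sym, Complex.ofReal_inv, Complex.ofReal_natCast]

lemma isGreatest_iSup {f : SU2 → ℝ} (hf : Continuous f) : IsGreatest (Set.range f) (⨆ g, f g) :=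
  (isCompact_range hf).isGreatest_sSup (Set.range_nonempty f)

lemma isGreatest_symSup (m : ℕ) (ε : ℝ) :
    IsGreatest (Set.range fun g ↦ ε * (Chebyshev.S ℝ m).eval (tr g)) (symSup m ε) := by
  simp only [symSup, character_sym, Complex.ofReal_re]
  exact isGreatest_iSup ((continuous_eval_chebyshevS_tr m).const_mul ε)

lemma isGreatest_eulerDSup (m : ℕ) (ε : ℝ) (p : Nat.Primes) :
    IsGreatest (Set.range fun g ↦ ε * Real.exp (logD m p g)) (eulerDSup m ε p) := by
  simp only [eulerDSup, eulerD_inv_sym, Complex.ofReal_re]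
  exact isGreatest_iSup ((Real.continuous_exp.comp (continuous_logD m p)).const_mul ε)

lemma isGreatest_mul_log_eulerDSup (m : ℕ) {ε : ℝ} (hε : ε = 1 ∨ ε = -1) (p : Nat.Primes) :
    IsGreatest (Set.range fun g ↦ ε * logD m p g) (ε * Real.log (ε * eulerDSup m ε p)) := by
  obtain ⟨⟨g₀, hg₀⟩, hmax⟩ := isGreatest_eulerDSup m ε p
  have hvalue : ε * Real.log (ε * eulerDSup m ε p) = ε * logD m p g₀ := by
    have hsq : ε * ε = 1 := by rcases hε with rfl | rfl <;> norm_num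
    rw [← hg₀, ← mul_assoc, hsq, one_mul, Real.log_exp]
  refine ⟨⟨g₀, hvalue.symm⟩, ?_⟩
  rintro _ ⟨g, rfl⟩
  have hle : ε * Real.exp (logD m p g) ≤ ε * Real.exp (logD m p g₀) :=
    (hmax ⟨g, rfl⟩).trans_eq hg₀.symm
  rw [hvalue]
  rcases hε with rfl | rfl
  · simpa only [one_mul, Real.exp_le_exp] using hle
  · simpa only [neg_one_mul, neg_le_neg_iff, Real.exp_le_exp] using hle

theorem summable_symOneTerm {m : ℕ} (hm : m ≠ 0) {ε : ℝ} (hε : ε = 1 ∨ ε = -1) :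
    Summable (symOneTerm m ε) := by
  obtain ⟨K, hl⟩ := exists_exponentFamily_logD hm (abs_eq zero_le_one |>.mpr hε)
  exact hl.summable_sub_div (isGreatest_symSup m ε) (isGreatest_mul_log_eulerDSup m hε)

/-! ### The logarithms of the Euler products -/

section EulerProduct

variable {m n : ℕ} {s : ℂ} {ρ : SU2 →* Matrix (Fin n) (Fin n) ℂ} {w : Nat.Primes → SU2 → ℝ}
  {c L : ℝ}

lemma localFactor_eq_localInt
    (hρ : ∀ (p : Nat.Primes) g, eulerD ((p : ℂ) ^ (-s)) ρ g = (w p g : ℂ)) (z : ℝ)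
    (p : Nat.Primes) :
    localFactor s 1 ρ (sym m) z p = (localInt haarSU2 w (logD m) z p : ℂ) := by
  rw [localFactor, localInt, ← integral_complex_ofReal]
  refine integral_congr_ae (.of_forall fun g ↦ ?_)
  dsimp only
  rw [hρ, Complex.cpow_neg_one, eulerD_inv_sym, ← Complex.ofReal_cpow (Real.exp_pos _).le,
    ← Complex.ofReal_mul, ← Real.exp_mul, mul_comm z]

lemma localInt_const_mul (l : Nat.Primes → SU2 → ℝ) (ε r : ℝ) :
    localInt haarSU2 w (fun p g ↦ ε * l p g) r = localInt haarSU2 w l (ε * r) := by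
  ext p
  simp only [localInt, ← mul_assoc, mul_comm r ε]

theorem hasProd_localFactor (hm : m ≠ 0)
    (hρ : ∀ (p : Nat.Primes) g, eulerD ((p : ℂ) ^ (-s)) ρ g = (w p g : ℂ))
    (hw : WeightFamily haarSU2 w c L) (z : ℝ) : HasProd (localFactor s 1 ρ (sym m) z)
      (Real.exp (∑' p, Real.log (localInt haarSU2 w (logD m) z p)) : ℂ) := by
  obtain ⟨K, hl⟩ := exists_exponentFamily_logD hm abs_one
  simp only [one_mul] at hl
  have h := (Real.hasProd_of_hasSum_log (localInt_pos hl hw z)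
    (summable_log_localInt hl hw z).hasSum).map Complex.ofRealHom Complex.continuous_ofReal
  simpa only [Function.comp_def, Complex.ofRealHom_eq_coe, ← localFactor_eq_localInt hρ] using h

theorem multipliable_and_twistedL_pos (hm : m ≠ 0)
    (hρ : ∀ (p : Nat.Primes) g, eulerD ((p : ℂ) ^ (-s)) ρ g = (w p g : ℂ))
    (hw : WeightFamily haarSU2 w c L) (z : ℝ) :
    Multipliable (localFactor s 1 ρ (sym m) z) ∧
      0 < (twistedL s 1 ρ (sym m) z).re ∧ (twistedL s 1 ρ (sym m) z).im = 0 := by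
  have h := hasProd_localFactor hm hρ hw z
  rw [twistedL, h.tprod_eq, Complex.ofReal_re, Complex.ofReal_im]
  exact ⟨h.multipliable, Real.exp_pos _, rfl⟩

theorem isBigO_log_twistedL_sub_mainTerm (hm : m ≠ 0)
    (hρ : ∀ (p : Nat.Primes) g, eulerD ((p : ℂ) ^ (-s)) ρ g = (w p g : ℂ))
    (hw : WeightFamily haarSU2 w c L) {ε : ℝ} (hε : ε = 1 ∨ ε = -1) :
    (fun r : ℝ ↦ Real.log (twistedL s 1 ρ (sym m) ((ε * r : ℝ) : ℂ)).re - mainTerm m ε r)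
      =O[atTop] fun r ↦ r / Real.log r := by
  obtain ⟨K, hl⟩ := exists_exponentFamily_logD hm (abs_eq zero_le_one |>.mpr hε)
  have h := isBigO_tsum_log_localInt hl hw (isGreatest_symSup m ε)
    (isGreatest_mul_log_eulerDSup m hε)
  simp only [localInt_const_mul] at h
  refine h.congr_left fun r ↦ ?_
  rw [twistedL, (hasProd_localFactor hm hρ hw _).tprod_eq, Complex.ofReal_re, Real.log_exp]
  rfl

end EulerProduct

end SymPow

open SymPow in
theorem mainTheorem6_general :
    (∃ C : ℝ, ∀ x : ℝ, 2 ≤ x →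
      |primeRecipSum x - (Real.log (Real.log x) + gammaStar)| ≤ C / Real.log x) ∧
    ∀ m ≠ 0,
      (∀ ε ∈ ({1, -1} : Set ℝ), Summable (symOneTerm m ε)) ∧
      (∀ r : ℝ,
        Multipliable (localFactor (1 / 2) 1 st (sym m) r) ∧
        0 < (twistedL (1 / 2) 1 st (sym m) r).re ∧
        (twistedL (1 / 2) 1 st (sym m) r).im = 0) ∧
      (∀ n ≠ 0, ∀ r : ℝ,
        Multipliable (localFactor 1 1 (sym n) (sym m) r) ∧
        0 < (twistedL 1 1 (sym n) (sym m) r).re ∧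
        (twistedL 1 1 (sym n) (sym m) r).im = 0) ∧
      ∀ ε ∈ ({1, -1} : Set ℝ),
        ((fun r : ℝ ↦ Real.log (twistedL (1 / 2) 1 st (sym m) ((ε * r : ℝ) : ℂ)).re -
          mainTerm m ε r) =O[atTop] fun r ↦ r / Real.log r) ∧
        ∀ n ≠ 0,
          (fun r : ℝ ↦ Real.log (twistedL 1 1 (sym n) (sym m) ((ε * r : ℝ) : ℂ)).re -
            mainTerm m ε r) =O[atTop] fun r ↦ r / Real.log r := by
  obtain ⟨c, L, hst⟩ := exists_weightFamily_st
  have hD_st (p : Nat.Primes) (g : SU2) :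
      eulerD ((p : ℂ) ^ (-(1 / 2) : ℂ)) st g = (eulerWeight 1 (1 / 2) p g : ℂ) := by
    simpa using eulerD_cpow_st (1 / 2) p g
  have hD_sym (n : ℕ) (p : Nat.Primes) (g : SU2) :
      eulerD ((p : ℂ) ^ (-1 : ℂ)) (sym n) g = (eulerWeight n 1 p g : ℂ) := by
    simpa only [Complex.ofReal_one] using eulerD_cpow_sym n 1 p g
  refine ⟨exists_abs_primeRecipSum_sub_gammaStar_le, fun m hm ↦ ⟨fun ε ↦ summable_symOneTerm hm,
    multipliable_and_twistedL_pos hm hD_st hst, fun n hn ↦ ?_, fun ε hε ↦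
      ⟨isBigO_log_twistedL_sub_mainTerm hm hD_st hst hε, fun n hn ↦ ?_⟩⟩⟩
  · obtain ⟨c', L', hsym⟩ := exists_weightFamily_sym hn
    exact multipliable_and_twistedL_pos hm (hD_sym n) hsym
  · obtain ⟨c', L', hsym⟩ := exists_weightFamily_sym hn
    exact isBigO_log_twistedL_sub_mainTerm hm (hD_sym n) hsym hε

theorem mainTheorem6 :
    (∃ C : ℝ, ∀ x : ℝ, 2 ≤ x →
      |SymPow.primeRecipSum x - (Real.log (Real.log x) + SymPow.gammaStar)| ≤ C / Real.log x) ∧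
    ∀ m ∈ ({1, 2, 4} : Set ℕ),
      (∀ ε ∈ ({1, -1} : Set ℝ), Summable (SymPow.symOneTerm m ε)) ∧
      (∀ r : ℝ,
        Multipliable (SymPow.localFactor (1 / 2) 1 SymPow.st (SymPow.sym m) r) ∧
        0 < (SymPow.twistedL (1 / 2) 1 SymPow.st (SymPow.sym m) r).re ∧
        (SymPow.twistedL (1 / 2) 1 SymPow.st (SymPow.sym m) r).im = 0) ∧
      (∀ r : ℝ,
        Multipliable (SymPow.localFactor 1 1 (SymPow.sym 2) (SymPow.sym m) r) ∧
        0 < (SymPow.twistedL 1 1 (SymPow.sym 2) (SymPow.sym m) r).re ∧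
        (SymPow.twistedL 1 1 (SymPow.sym 2) (SymPow.sym m) r).im = 0) ∧
      ∀ ε ∈ ({1, -1} : Set ℝ),
        ((fun r : ℝ =>
            Real.log (SymPow.twistedL (1 / 2) 1 SymPow.st (SymPow.sym m) ((ε * r : ℝ) : ℂ)).re -
              SymPow.mainTerm m ε r) =O[atTop] fun r : ℝ => r / Real.log r) ∧
        ((fun r : ℝ =>
            Real.log (SymPow.twistedL 1 1 (SymPow.sym 2) (SymPow.sym m) ((ε * r : ℝ) : ℂ)).re -
              SymPow.mainTerm m ε r) =O[atTop] fun r : ℝ => r / Real.log r) := by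
  obtain ⟨hmertens, h⟩ := mainTheorem6_general
  refine ⟨hmertens, fun m hm ↦ ?_⟩
  have hm₀ : m ≠ 0 := by rintro rfl; simp at hm
  obtain ⟨hsum, hst, hsym, hasymp⟩ := h m hm₀
  exact ⟨hsum, hst, hsym 2 two_ne_zero, fun ε hε ↦
    ⟨(hasymp ε hε).1, (hasymp ε hε).2 2 two_ne_zero⟩⟩
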